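/- Let $\Gamma$ be a compact, connected, finite metric graph with finite vertex set $\mathcal V$ and finite non-empty edge set $\mathcal E$; each edge $e$ is identified with an interval $(0,l_e)$, $0<l_e<\infty$, whose ends are attached to vertices (loops and multiple edges are allowed). Let $V=(v_e)_{e\in\mathcal E}$ be a real-valued potential with $v_e\in (C^\infty\cap L^\infty)(0,l_e)$ for every $e$, and let $\sigma=(\sigma_v)_{v\in\mathcal V}\in\mathbb R^{\mathcal V}$. In $L^2(\Gamma)=\bigoplus_{e\in\mathcal E}L^2(0,l_e)$ let $H^V_\sigma$ be the operator $(H^V_\sigma f)_e=-f_e''+v_ef_e$ whose domain consists of all $f=(f_e)_{e\in\mathcal E}$ with $f_e\in H^2(0,l_e)$ for all $e$ that are continuous across the vertices and satisfy $\sum_{e\sim v}\partial_vf_e(v)=\sigma_vf(v)$ at every vertex $v$, where the sum runs over all edge ends at $v$ and $\partial_v$ denotes the inward derivative. The eigenvalues of $H^V_\sigma$ are real and of finite multiplicity, and they form a sequence $\lambda^V_0(\sigma)\le\lambda^V_1(\sigma)\le\cdots$, counted with multiplicity; write $\lambda^0_n(0)$ for those of the operator with $V=0$ and $\sigma=0$.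 Then there is a constant $C=C(\Gamma,V,\sigma)>0$ such that, for every $n\in\mathbb N=\{0,1,2,\dots\}$, $$|\lambda^V_n(\sigma)-\lambda^V_n(0)|\le C\qquad\text{and}\qquad|\lambda^V_n(\sigma)-\lambda^0_n(0)|\le C .$$ -/

import Mathlib

noncomputable section

namespace QuantumGraph

open MeasureTheory Set
open scoped ContDiff

/-! ### Sobolev functions on a bounded interval -/

/-- The complex Hilbert space `L²(0, l)`. -/
abbrev IntervalL2 (l : ℝ) : Type := Lp ℂ 2 (volume.restrict (Ioo (0 : ℝ) l))

/-- `w` is the weak derivative of `u` on `(0, l)`: for every test function `φ ∈ C_c^∞(0, l)`,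
`∫ φ' u = - ∫ φ w`. -/
def IsWeakDeriv {l : ℝ} (u w : IntervalL2 l) : Prop :=
  ∀ φ : ℝ → ℝ, ContDiff ℝ ∞ φ → HasCompactSupport φ → tsupport φ ⊆ Ioo 0 l →
    ∫ x in Ioo 0 l, deriv φ x • u x = - ∫ x in Ioo 0 l, φ x • w x

theorem integrable_testFun_smul {l : ℝ} (u : IntervalL2 l) {ψ : ℝ → ℝ} (hψ : Continuous ψ)
    (hc : HasCompactSupport ψ) : IntegrableOn (fun x => ψ x • u x) (Ioo 0 l) := by
  have hu : Integrable (fun x => u x) (volume.restrict (Ioo (0 : ℝ) l)) :=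
    (Lp.memLp u).integrable (by norm_num)
  obtain ⟨M, hM⟩ := hc.exists_bound_of_continuous hψ
  exact hu.bdd_smul M hψ.aestronglyMeasurable (Filter.Eventually.of_forall hM)

theorem IsWeakDeriv.add {l : ℝ} {u w u' w' : IntervalL2 l} (h : IsWeakDeriv u w)
    (h' : IsWeakDeriv u' w') : IsWeakDeriv (u + u') (w + w') := by
  intro φ h1 h2 h3
  have hd : Continuous (deriv φ) := h1.continuous_deriv (by simp)
  have e1 : ∫ x in Ioo 0 l, deriv φ x • (u + u') x
      = ∫ x in Ioo 0 l, (deriv φ x • u x + deriv φ x • u' x) := by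
    apply integral_congr_ae
    filter_upwards [Lp.coeFn_add u u'] with x hx
    rw [hx, Pi.add_apply, smul_add]
  have e2 : ∫ x in Ioo 0 l, φ x • (w + w') x
      = ∫ x in Ioo 0 l, (φ x • w x + φ x • w' x) := by
    apply integral_congr_ae
    filter_upwards [Lp.coeFn_add w w'] with x hx
    rw [hx, Pi.add_apply, smul_add]
  rw [e1, e2, integral_add (integrable_testFun_smul u hd h2.deriv)
    (integrable_testFun_smul u' hd h2.deriv),
    integral_add (integrable_testFun_smul w h1.continuous h2)
    (integrable_testFun_smul w' h1.continuous h2), h φ h1 h2 h3, h' φ h1 h2 h3]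
  ring

theorem IsWeakDeriv.smul {l : ℝ} {u w : IntervalL2 l} (h : IsWeakDeriv u w) (c : ℂ) :
    IsWeakDeriv (c • u) (c • w) := by
  intro φ h1 h2 h3
  have e1 : ∫ x in Ioo 0 l, deriv φ x • (c • u) x
      = ∫ x in Ioo 0 l, c • (deriv φ x • u x) := by
    apply integral_congr_ae
    filter_upwards [Lp.coeFn_smul c u] with x hx
    rw [hx, Pi.smul_apply, smul_comm]
  have e2 : ∫ x in Ioo 0 l, φ x • (c • w) x
      = ∫ x in Ioo 0 l, c • (φ x • w x) := by
    apply integral_congr_ae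
    filter_upwards [Lp.coeFn_smul c w] with x hx
    rw [hx, Pi.smul_apply, smul_comm]
  rw [e1, e2, integral_smul, integral_smul, h φ h1 h2 h3, smul_neg]

theorem isWeakDeriv_zero {l : ℝ} : IsWeakDeriv (0 : IntervalL2 l) 0 := by
  have h : ∀ ψ : ℝ → ℝ, ∫ x in Ioo 0 l, ψ x • (0 : IntervalL2 l) x = 0 := by
    intro ψ
    rw [← integral_zero ℝ ℂ (μ := volume.restrict (Ioo (0 : ℝ) l))]
    apply integral_congr_ae
    filter_upwards [Lp.coeFn_zero ℂ 2 (volume.restrict (Ioo (0 : ℝ) l))] with x hx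
    rw [hx, Pi.zero_apply, smul_zero]
  intro φ _ _ _
  rw [h, h, neg_zero]

theorem IsWeakDeriv.unique {l : ℝ} {u w w' : IntervalL2 l} (h : IsWeakDeriv u w)
    (h' : IsWeakDeriv u w') : w = w' := by
  have hw : ∀ z : IntervalL2 l, Integrable (fun x => z x) (volume.restrict (Ioo (0 : ℝ) l)) :=
    fun z => (Lp.memLp z).integrable (by norm_num)
  have key := isOpen_Ioo.ae_eq_zero_of_integral_contDiff_smul_eq_zero (μ := volume)
    (U := Ioo (0 : ℝ) l) (f := fun x => w x - w' x)
    (IntegrableOn.locallyIntegrableOn ((hw w).sub (hw w'))) (by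
      intro g hg hc hs
      have e : ∫ x, g x • (w x - w' x) = ∫ x in Ioo 0 l, g x • (w x - w' x) := by
        symm
        apply setIntegral_eq_integral_of_forall_compl_eq_zero
        intro x hx
        rw [image_eq_zero_of_notMem_tsupport (fun hx' => hx (hs hx')), zero_smul]
      rw [e]
      simp only [smul_sub]
      rw [integral_sub (integrable_testFun_smul w hg.continuous hc)
        (integrable_testFun_smul w' hg.continuous hc)]
      have a := h g hg hc hs
      rw [h' g hg hc hs] at a
      rw [sub_eq_zero]
      exact (neg_injective a).symm)
  apply Lp.ext
  rw [Filter.EventuallyEq, ae_restrict_iff' measurableSet_Ioo]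
  filter_upwards [key] with x hx hxm
  exact sub_eq_zero.mp (hx hxm)

open Classical in
/-- The weak derivative `u' ∈ L²(0, l)` (with value `0` if `u` has no weak derivative in `L²`). -/
def weakDeriv {l : ℝ} (u : IntervalL2 l) : IntervalL2 l :=
  if h : ∃ w, IsWeakDeriv u w then h.choose else 0

theorem IsWeakDeriv.weakDeriv_eq {l : ℝ} {u w : IntervalL2 l} (h : IsWeakDeriv u w) :
    weakDeriv u = w := by
  have h' : ∃ w, IsWeakDeriv u w := ⟨w, h⟩
  rw [weakDeriv, dif_pos h']
  exact h'.choose_spec.unique h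

/-- The Sobolev space `H¹(0, l)`. -/
def H1 (l : ℝ) : Submodule ℂ (IntervalL2 l) where
  carrier := {u | ∃ w, IsWeakDeriv u w}
  add_mem' := by
    rintro _ _ ⟨w, h⟩ ⟨w', h'⟩
    exact ⟨_, h.add h'⟩
  zero_mem' := ⟨0, isWeakDeriv_zero⟩
  smul_mem' := by
    rintro c _ ⟨w, h⟩
    exact ⟨_, h.smul c⟩

theorem isWeakDeriv_weakDeriv {l : ℝ} {u : IntervalL2 l} (h : u ∈ H1 l) :
    IsWeakDeriv u (weakDeriv u) := by
  obtain ⟨w, hw⟩ := h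
  rwa [hw.weakDeriv_eq]

theorem weakDeriv_add {l : ℝ} {u v : IntervalL2 l} (hu : u ∈ H1 l) (hv : v ∈ H1 l) :
    weakDeriv (u + v) = weakDeriv u + weakDeriv v :=
  ((isWeakDeriv_weakDeriv hu).add (isWeakDeriv_weakDeriv hv)).weakDeriv_eq

theorem weakDeriv_smul {l : ℝ} {u : IntervalL2 l} (hu : u ∈ H1 l) (c : ℂ) :
    weakDeriv (c • u) = c • weakDeriv u :=
  ((isWeakDeriv_weakDeriv hu).smul c).weakDeriv_eq

theorem weakDeriv_zero {l : ℝ} : weakDeriv (0 : IntervalL2 l) = 0 :=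
  isWeakDeriv_zero.weakDeriv_eq

/-- The Sobolev space `H²(0, l)`: `u`, `u'` and `u''` belong to `L²(0, l)`. -/
def H2 (l : ℝ) : Submodule ℂ (IntervalL2 l) where
  carrier := {u | u ∈ H1 l ∧ weakDeriv u ∈ H1 l}
  add_mem' := by
    rintro u v ⟨hu, hu'⟩ ⟨hv, hv'⟩
    exact ⟨add_mem hu hv, by rw [weakDeriv_add hu hv]; exact add_mem hu' hv'⟩
  zero_mem' := ⟨zero_mem _, by rw [weakDeriv_zero]; exact zero_mem _⟩
  smul_mem' := by
    rintro c u ⟨hu, hu'⟩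
    exact ⟨Submodule.smul_mem _ c hu, by
      rw [weakDeriv_smul hu]; exact Submodule.smul_mem _ c hu'⟩

/-- The continuous representative of `u` on `[0, l]` has the value `a` at `0` and `b` at `l`. -/
def HasBoundaryValues {l : ℝ} (u : IntervalL2 l) (a b : ℂ) : Prop :=
  ∃ F : ℝ → ℂ, ContinuousOn F (Icc 0 l) ∧ (∀ᵐ x ∂volume.restrict (Ioo (0 : ℝ) l), u x = F x) ∧
    F 0 = a ∧ F l = b

theorem HasBoundaryValues.add {l : ℝ} {u u' : IntervalL2 l} {a b a' b' : ℂ}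
    (h : HasBoundaryValues u a b) (h' : HasBoundaryValues u' a' b') :
    HasBoundaryValues (u + u') (a + a') (b + b') := by
  obtain ⟨F, hF, hu, rfl, rfl⟩ := h
  obtain ⟨F', hF', hu', rfl, rfl⟩ := h'
  refine ⟨fun x => F x + F' x, hF.add hF', ?_, rfl, rfl⟩
  filter_upwards [hu, hu', Lp.coeFn_add u u'] with x h1 h2 h3
  rw [h3, Pi.add_apply, h1, h2]

theorem HasBoundaryValues.smul {l : ℝ} {u : IntervalL2 l} {a b : ℂ}
    (h : HasBoundaryValues u a b) (c : ℂ) : HasBoundaryValues (c • u) (c * a) (c * b) := by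
  obtain ⟨F, hF, hu, rfl, rfl⟩ := h
  refine ⟨fun x => c * F x, continuousOn_const.mul hF, ?_, rfl, rfl⟩
  filter_upwards [hu, Lp.coeFn_smul c u] with x h1 h3
  rw [h3, Pi.smul_apply, h1, smul_eq_mul]

theorem hasBoundaryValues_zero {l : ℝ} : HasBoundaryValues (0 : IntervalL2 l) 0 0 := by
  refine ⟨fun _ => 0, continuousOn_const, ?_, rfl, rfl⟩
  filter_upwards [Lp.coeFn_zero ℂ 2 (volume.restrict (Ioo (0 : ℝ) l))] with x hx
  rw [hx, Pi.zero_apply]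

/-! ### Compact metric graphs -/

/-- A metric graph with vertex set `Vtx` and edge set `E` (loops and multiple edges are allowed).
The edge `e` is the interval `(0, len e)`, whose end `0` is attached to the vertex `src e` and
whose end `len e` is attached to the vertex `tgt e`. -/
structure MetricGraph (Vtx E : Type*) where
  src : E → Vtx
  tgt : E → Vtx
  len : E → ℝ
  len_pos : ∀ e, 0 < len e

namespace MetricGraph

variable {Vtx E : Type*}

/-- Any two vertices are joined by a path of edges. -/
def Connected (Γ : MetricGraph Vtx E) : Prop :=
  (SimpleGraph.fromRel fun v w : Vtx => ∃ e, Γ.src e = v ∧ Γ.tgt e = w).Connected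

/-- The Hilbert space `L²(Γ) = ⨁ₑ L²(0, len e)`. -/
abbrev L2 [Fintype E] (Γ : MetricGraph Vtx E) : Type _ :=
  PiLp 2 fun e : E => IntervalL2 (Γ.len e)

/-- Real-valued potentials, smooth and bounded on each open edge `(0, len e)`. (The values outside
the open edges play no role.) -/
structure Potential (Γ : MetricGraph Vtx E) where
  toFun : E → ℝ → ℝ
  smooth : ∀ e, ContDiffOn ℝ ∞ (toFun e) (Ioo 0 (Γ.len e))
  bounded : ∀ e, ∃ M, ∀ x ∈ Ioo 0 (Γ.len e), |toFun e x| ≤ M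

/-- The zero potential. -/
instance (Γ : MetricGraph Vtx E) : Zero Γ.Potential where
  zero := ⟨fun _ _ => 0, fun _ => contDiffOn_const, fun _ => ⟨0, by simp⟩⟩

theorem Potential.memLp_mul {Γ : MetricGraph Vtx E} (V : Γ.Potential) (e : E)
    (u : IntervalL2 (Γ.len e)) :
    MemLp (fun x => (V.toFun e x : ℂ) * u x) 2 (volume.restrict (Ioo 0 (Γ.len e))) := by
  obtain ⟨M, hM⟩ := V.bounded e
  have hm : AEStronglyMeasurable (fun x => (V.toFun e x : ℂ))
      (volume.restrict (Ioo 0 (Γ.len e))) :=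
    (Complex.continuous_ofReal.comp_continuousOn
      (V.smooth e).continuousOn).aestronglyMeasurable measurableSet_Ioo
  refine MemLp.of_le_mul (c := M) (Lp.memLp u) (hm.mul (Lp.memLp u).1) ?_
  rw [ae_restrict_iff' measurableSet_Ioo]
  refine Filter.Eventually.of_forall fun x hx => ?_
  rw [norm_mul, Complex.norm_real, Real.norm_eq_abs]
  exact mul_le_mul_of_nonneg_right (hM x hx) (norm_nonneg _)

/-- Multiplication by the potential on one edge. -/
def Potential.mul {Γ : MetricGraph Vtx E} (V : Γ.Potential) (e : E) :
    IntervalL2 (Γ.len e) →ₗ[ℂ] IntervalL2 (Γ.len e) where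
  toFun u := (V.memLp_mul e u).toLp
  map_add' u v := by
    rw [← MemLp.toLp_add]
    apply MemLp.toLp_congr
    filter_upwards [Lp.coeFn_add u v] with x hx
    rw [hx, Pi.add_apply, Pi.add_apply, mul_add]
  map_smul' c u := by
    rw [RingHom.id_apply, ← MemLp.toLp_const_smul]
    apply MemLp.toLp_congr
    filter_upwards [Lp.coeFn_smul c u] with x hx
    rw [hx, Pi.smul_apply, Pi.smul_apply, smul_eq_mul, smul_eq_mul, mul_left_comm]

variable [Fintype E] [DecidableEq Vtx]

/-- The domain `𝒟_σ`: functions with components in `H²(0, len e)` which are continuous across the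
vertices, with common value `a v` at the vertex `v`, and which satisfy at every vertex `v` the
`δ`-coupling condition that the sum of the inward derivatives over all edge ends at `v` equals
`σ v * a v`. Here `p e` and `q e` are the values of the derivative of the `e`-th component at `0`
and at `len e`; the inward derivative at `len e` is `-q e`. -/
def domain (Γ : MetricGraph Vtx E) (σ : Vtx → ℝ) : Submodule ℂ Γ.L2 where
  carrier := {f | (∀ e, f e ∈ H2 (Γ.len e)) ∧ ∃ (a : Vtx → ℂ) (p q : E → ℂ),
    (∀ e, HasBoundaryValues (f e) (a (Γ.src e)) (a (Γ.tgt e))) ∧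
    (∀ e, HasBoundaryValues (weakDeriv (f e)) (p e) (q e)) ∧
    ∀ v, ∑ e, ((if Γ.src e = v then p e else 0) + (if Γ.tgt e = v then -q e else 0))
      = σ v * a v}
  add_mem' := by
    rintro f g ⟨hf, a, p, q, h1, h2, h3⟩ ⟨hg, a', p', q', h1', h2', h3'⟩
    refine ⟨fun e => add_mem (hf e) (hg e), fun v => a v + a' v, fun e => p e + p' e,
      fun e => q e + q' e, fun e => (h1 e).add (h1' e), fun e => ?_, fun v => ?_⟩
    · rw [PiLp.add_apply, weakDeriv_add (hf e).1 (hg e).1]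
      exact (h2 e).add (h2' e)
    · rw [mul_add, ← h3 v, ← h3' v, ← Finset.sum_add_distrib]
      refine Finset.sum_congr rfl fun e _ => ?_
      split_ifs <;> ring
  zero_mem' := by
    refine ⟨fun e => zero_mem _, fun _ => 0, fun _ => 0, fun _ => 0,
      fun e => hasBoundaryValues_zero, fun e => ?_, fun v => by simp⟩
    rw [PiLp.zero_apply, weakDeriv_zero]
    exact hasBoundaryValues_zero
  smul_mem' := by
    rintro c f ⟨hf, a, p, q, h1, h2, h3⟩
    refine ⟨fun e => Submodule.smul_mem _ c (hf e), fun v => c * a v, fun e => c * p e,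
      fun e => c * q e, fun e => (h1 e).smul c, fun e => ?_, fun v => ?_⟩
    · rw [PiLp.smul_apply, weakDeriv_smul (hf e).1]
      exact (h2 e).smul c
    · rw [mul_left_comm, ← h3 v, Finset.mul_sum]
      refine Finset.sum_congr rfl fun e _ => ?_
      split_ifs <;> ring

/-- The Schrödinger operator `H^V_σ = (-Δ + V, 𝒟_σ)` as an unbounded operator in `L²(Γ)`:
`(H^V_σ f)_e = -f_e'' + V_e f_e`. -/
def schrodinger (Γ : MetricGraph Vtx E) (V : Γ.Potential) (σ : Vtx → ℝ) :
    Γ.L2 →ₗ.[ℂ] Γ.L2 where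
  domain := Γ.domain σ
  toFun :=
    { toFun := fun f => WithLp.toLp 2 fun e =>
        -weakDeriv (weakDeriv (f.1 e)) + V.mul e (f.1 e)
      map_add' := by
        intro f g
        ext1 e
        have hf := f.2.1 e
        have hg := g.2.1 e
        change -weakDeriv (weakDeriv (f.1 e + g.1 e)) + V.mul e (f.1 e + g.1 e) =
          (-weakDeriv (weakDeriv (f.1 e)) + V.mul e (f.1 e)) +
            (-weakDeriv (weakDeriv (g.1 e)) + V.mul e (g.1 e))
        rw [weakDeriv_add hf.1 hg.1, weakDeriv_add hf.2 hg.2, map_add]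
        abel
      map_smul' := by
        intro c f
        ext1 e
        have hf := f.2.1 e
        change -weakDeriv (weakDeriv (c • f.1 e)) + V.mul e (c • f.1 e) =
          c • (-weakDeriv (weakDeriv (f.1 e)) + V.mul e (f.1 e))
        rw [weakDeriv_smul hf.1, weakDeriv_smul hf.2, map_smul, smul_add, smul_neg] }

end MetricGraph

/-! ### Eigenvalues counted with multiplicity -/

/-- The eigenspace `{f ∈ dom T | T f = z f}` of an unbounded operator `T`. -/
def eigenspace {H : Type*} [AddCommGroup H] [Module ℂ H] (T : H →ₗ.[ℂ] H) (z : ℂ) :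
    Submodule ℂ H where
  carrier := {f | ∃ h : f ∈ T.domain, T ⟨f, h⟩ = z • f}
  add_mem' := by
    rintro f g ⟨hf, ef⟩ ⟨hg, eg⟩
    refine ⟨add_mem hf hg, ?_⟩
    have h := T.map_add ⟨f, hf⟩ ⟨g, hg⟩
    rw [ef, eg, ← smul_add] at h
    exact h
  zero_mem' := ⟨zero_mem _, by
    rw [smul_zero]
    exact T.map_zero⟩
  smul_mem' := by
    rintro c f ⟨hf, ef⟩
    refine ⟨Submodule.smul_mem _ c hf, ?_⟩
    have h := T.map_smul c ⟨f, hf⟩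
    rw [ef, smul_comm] at h
    exact h

/-- `lam 0 ≤ lam 1 ≤ …` are all the eigenvalues of `T`, counted with multiplicity: every complex
number `z` occurs in the sequence exactly as often as the dimension of the eigenspace of `T` at
`z` (not at all, if `z` is no eigenvalue), and these dimensions are finite. -/
structure IsEigenvalueEnumeration {H : Type*} [AddCommGroup H] [Module ℂ H] (T : H →ₗ.[ℂ] H)
    (lam : ℕ → ℝ) : Prop where
  monotone : Monotone lam
  finite : ∀ z : ℂ, Module.Finite ℂ (eigenspace T z)
  count : ∀ z : ℂ, {n | (lam n : ℂ) = z}.encard = Module.finrank ℂ (eigenspace T z)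

/-- An operator has at most one such enumeration. -/
theorem IsEigenvalueEnumeration.unique {H : Type*} [AddCommGroup H] [Module ℂ H]
    {T : H →ₗ.[ℂ] H} {a b : ℕ → ℝ} (ha : IsEigenvalueEnumeration T a)
    (hb : IsEigenvalueEnumeration T b) : a = b := by
  have key : ∀ (a b : ℕ → ℝ), IsEigenvalueEnumeration T a → IsEigenvalueEnumeration T b →
      ∀ n, (∀ m < n, a m = b m) → ¬ a n < b n := by
    intro a b ha hb n ih hlt
    have hsub : {m | (b m : ℂ) = (a n : ℂ)} ⊂ {m | (a m : ℂ) = (a n : ℂ)} := by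
      refine ⟨fun m hm => ?_, fun h => ?_⟩
      · have hm' : b m = a n := Complex.ofReal_injective hm
        have hmn : m < n := by
          by_contra hc
          exact absurd (hb.monotone (not_lt.mp hc)) (by rw [hm']; exact not_le.mpr hlt)
        change (a m : ℂ) = a n
        rw [ih m hmn, hm']
      · have h0 : (b n : ℂ) = (a n : ℂ) := h (show n ∈ {m | (a m : ℂ) = (a n : ℂ)} from rfl)
        exact hlt.ne' (Complex.ofReal_injective h0)
    have hfin : {m | (b m : ℂ) = (a n : ℂ)}.Finite := by
      rw [← Set.encard_lt_top_iff, hb.count]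
      exact ENat.natCast_lt_top _
    have := hfin.encard_lt_encard hsub
    rw [ha.count, hb.count] at this
    exact lt_irrefl _ this
  funext n
  induction n using Nat.strong_induction_on with
  | _ n ih =>
    exact le_antisymm (not_lt.mp (key b a hb ha n fun m hm => (ih m hm).symm))
      (not_lt.mp (key a b ha hb n ih))

end QuantumGraph

end

/-!
The eigenvalues of `H^V_σ` are those of the quadratic form `‖f'‖² + ⟪V f, f⟫ + ∑ σ v |f v|²` on
the functions in `H¹` of the edges that are continuous across the vertices. This form domain is
modelled as the Hilbert space of all pairs of vertex values and derivatives that fit together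
(`MetricGraph.FormDomain`); it is compactly embedded in `L²(Γ)`, and the trace inequality makes the
form coercive, so that there is a complete sequence of eigenvectors with a min-max principle
(`exists_isFormSpectrum`). Integration by parts identifies the eigenvectors of the form with the
eigenfunctions of the operator (`MetricGraph.mem_eigenspace_schrodinger_iff`), so that the
eigenvalues agree with their multiplicities.

Two such forms differ by a bounded form and by at most a multiple of `∑ |f v|²`. The latter is not
bounded on `L²(Γ)`, but two facts about the first operator make its effect on the eigenvalues
bounded.

* Its normalised eigenfunctions are bounded at the vertices
  (`MetricGraph.Connected.exists_norm_vertexValue_eigenvector_sq_le`), because the energy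
  `|f'|² + λ |f|²` is almost constant along each edge (`abs_energy_sub_le`).
* Its eigenvalues are spaced quadratically: any window of a small fixed width for `√λ` contains at
  most `2 |E|` of them, if `λ` is large. For more than `2 |E|` eigenfunctions have a nontrivial
  combination with vanishing initial data on every edge, and by the energy estimate such a function
  cannot almost satisfy the equation `-f'' = λ f` (`MetricGraph.le_mul_of_eigenvalues_mem_Icc`).

Let `w 0, …, w n` be the first eigenvectors, with eigenvalues `lam k`. By the min-max principle some
combination `f = ∑ c k • w k` has a Rayleigh quotient for the second form of at least its `n`-th
eigenvalue. By the Cauchy-Schwarz inequality `|f v|² ≤ (∑ d k |c k|²) (∑ |w k v|² / d k)` with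
`d k = lam n - lam k + C`. The second factor is as small as desired for large `C`, uniformly in `n`,
since it is dominated by a sum of inverse squares, and the first one is exactly what the Rayleigh
quotient of the first form lacks to `lam n + C`. Hence the `n`-th eigenvalue of the second form is
at most `lam n` plus a constant (`IsFormSpectrum.exists_le_add`), and the roles of the two forms may
be exchanged.
-/

noncomputable section

namespace QuantumGraph

open MeasureTheory Set
open scoped ContDiff

open Filter Topology
open scoped ComplexConjugate InnerProductSpace

/-! ### Compact positive operators -/

section Abstract

variable {H : Type*} [NormedAddCommGroup H] [InnerProductSpace ℂ H] [CompleteSpace H]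

/-- A compact positive operator attains its norm at an eigenvector. -/
theorem exists_unit_eigenvector_norm [Nontrivial H] {S : H →L[ℂ] H} (hc : IsCompactOperator S)
    (hs : S.IsSymmetric) (hpos : ∀ x, x ≠ 0 → 0 < (⟪S x, x⟫_ℂ).re) :
    0 < ‖S‖ ∧ ∃ x, ‖x‖ = 1 ∧ S x = (‖S‖ : ℂ) • x := by
  obtain ⟨x₀, hx₀⟩ := exists_ne (0 : H)
  have hS : 0 < ‖S‖ := by
    rw [norm_pos_iff]
    rintro rfl
    simpa using hpos x₀ hx₀
  refine ⟨hS, ?_⟩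
  have hS0 : (‖S‖ : ℂ) ≠ 0 := by exact_mod_cast hS.ne'
  rcases hc.hasEigenvalue_or_mem_resolventSet hS0 with h | h
  · obtain ⟨v, hv, hv0⟩ := h.exists_hasEigenvector
    have hv' : S v = (‖S‖ : ℂ) • v := Module.End.mem_eigenspace_iff.mp hv
    refine ⟨((‖v‖⁻¹ : ℝ) : ℂ) • v, ?_, ?_⟩
    · rw [norm_smul, Complex.norm_real, norm_inv, norm_norm,
        inv_mul_cancel₀ (norm_ne_zero_iff.mpr hv0)]
    · rw [map_smul, hv', smul_comm]
  · exfalso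
    obtain ⟨ε, hε, hle⟩ := S.rayleighQuotient_le_of_norm_mem_resolventSet h
    have h1 := S.norm_eq_iSup_rayleighQuotient hs
    have h2 : ⨆ x, |S.rayleighQuotient x| ≤ ‖S‖ - ε := by
      refine ciSup_le fun x => ?_
      rw [abs_of_nonneg]
      · exact hle x
      · rw [ContinuousLinearMap.rayleighQuotient]
        refine div_nonneg ?_ (by positivity)
        by_cases hx : x = 0
        · simp [hx, ContinuousLinearMap.reApplyInnerSelf]
        · exact (hpos x hx).le
    linarith

/-- The induction step of the spectral theorem: the orthogonal complement of an invariant subspace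
of finite dimension contains a unit eigenvector that maximises the quadratic form among the unit
vectors there. -/
theorem exists_unit_eigenvector_orthogonal {S : H →L[ℂ] H} (hc : IsCompactOperator S)
    (hs : S.IsSymmetric) (hpos : ∀ x, x ≠ 0 → 0 < (⟪S x, x⟫_ℂ).re) (hH : ¬ FiniteDimensional ℂ H)
    (F : Submodule ℂ H) (hF : FiniteDimensional ℂ F) (hSF : ∀ x ∈ F, S x ∈ F) :
    ∃ (x : H) (μ : ℝ), x ∈ Fᗮ ∧ ‖x‖ = 1 ∧ 0 < μ ∧ S x = (μ : ℂ) • x ∧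
      ∀ y ∈ Fᗮ, (⟪S y, y⟫_ℂ).re ≤ μ * ‖y‖ ^ 2 := by
  have hinv : ∀ x ∈ Fᗮ, S x ∈ Fᗮ := by
    intro x hx y hy
    have h := hs y x
    rw [ContinuousLinearMap.coe_coe] at h
    rw [← h]
    exact hx _ (hSF y hy)
  have hne : Nontrivial Fᗮ := by
    rw [Submodule.nontrivial_iff_ne_bot]
    intro hbot
    rw [Submodule.orthogonal_eq_bot_iff] at hbot
    subst hbot
    exact hH (LinearEquiv.finiteDimensional (Submodule.topEquiv (R := ℂ) (M := H)))
  let S' : Fᗮ →L[ℂ] Fᗮ := S.restrict hinv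
  have hS' : ∀ x : Fᗮ, ((S' x : Fᗮ) : H) = S x := fun x => rfl
  have hc' : IsCompactOperator S' := hc.restrict' hinv
  have hs' : S'.IsSymmetric := hs.restrict_invariant hinv
  obtain ⟨h0, x, hx, hex⟩ := exists_unit_eigenvector_norm hc' hs' (fun x hx => by
    rw [Submodule.coe_inner, hS']
    exact hpos _ (by simpa using hx))
  refine ⟨x, ‖S'‖, x.2, by simpa using hx, h0, ?_, ?_⟩
  · rw [← hS', hex]; rfl
  · intro y hy
    have h1 : ‖⟪S' ⟨y, hy⟩, ⟨y, hy⟩⟫_ℂ‖ ≤ ‖S'‖ * ‖y‖ ^ 2 := by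
      refine (norm_inner_le_norm _ _).trans ?_
      rw [pow_two, ← mul_assoc]
      exact mul_le_mul_of_nonneg_right (S'.le_opNorm _) (norm_nonneg _)
    exact (Complex.re_le_norm _).trans h1

/-- The spectral theorem for a strictly positive compact operator `S` on an infinite-dimensional
Hilbert space, with the eigenvalues in decreasing order: the `n`-th eigenvector is a maximiser of
the quadratic form on the orthogonal complement of its predecessors. -/
theorem exists_antitone_eigenbasis {S : H →L[ℂ] H} (hc : IsCompactOperator S)
    (hs : S.IsSymmetric) (hpos : ∀ x, x ≠ 0 → 0 < (⟪S x, x⟫_ℂ).re) (hH : ¬ FiniteDimensional ℂ H) :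
    ∃ (e : ℕ → H) (μ : ℕ → ℝ), Orthonormal ℂ e ∧ Antitone μ ∧ (∀ n, 0 < μ n) ∧
      Tendsto μ atTop (𝓝 0) ∧ (∀ n, S (e n) = (μ n : ℂ) • e n) ∧
      ∀ n y, (∀ k < n, ⟪e k, y⟫_ℂ = 0) → (⟪S y, y⟫_ℂ).re ≤ μ n * ‖y‖ ^ 2 := by
  let P := {F : Submodule ℂ H // FiniteDimensional ℂ F ∧ ∀ x ∈ F, S x ∈ F}
  choose x m hx1 hx2 hm hx3 hx4 using fun F : P =>
    exists_unit_eigenvector_orthogonal hc hs hpos hH F.1 F.2.1 F.2.2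
  let step : P → P := fun F => ⟨F.1 ⊔ Submodule.span ℂ {x F}, by
    have := F.2.1
    infer_instance, by
    intro y hy
    obtain ⟨a, ha, b, hb, rfl⟩ := Submodule.mem_sup.mp hy
    obtain ⟨c, rfl⟩ := Submodule.mem_span_singleton.mp hb
    rw [map_add, map_smul, hx3]
    refine add_mem (Submodule.mem_sup_left (F.2.2 a ha)) (Submodule.mem_sup_right ?_)
    exact Submodule.smul_mem _ _ (Submodule.smul_mem _ _ (Submodule.mem_span_singleton_self _))⟩
  let P₀ : P := ⟨⊥, inferInstance, by simp⟩
  let F : ℕ → P := fun n => step^[n] P₀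
  have hF : ∀ n, (F (n + 1)).1 = (F n).1 ⊔ Submodule.span ℂ {x (F n)} := by
    intro n
    simp only [F, Function.iterate_succ_apply']
    rfl
  have hmono : Monotone fun n => (F n).1 := monotone_nat_of_le_succ fun n => by
    rw [hF]; exact le_sup_left
  have hmem : ∀ {k n}, k < n → x (F k) ∈ (F n).1 := by
    intro k n hkn
    apply hmono (Nat.succ_le_of_lt hkn)
    change _ ∈ (F (k + 1)).1
    rw [hF]
    exact Submodule.mem_sup_right (Submodule.mem_span_singleton_self _)
  have hperp : ∀ n y, (∀ k < n, ⟪x (F k), y⟫_ℂ = 0) → y ∈ (F n).1ᗮ := by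
    intro n
    induction n with
    | zero =>
      intro y _
      change y ∈ (⊥ : Submodule ℂ H)ᗮ
      simp
    | succ n ih =>
      intro y hy
      rw [hF, ← Submodule.inf_orthogonal]
      refine ⟨ih y fun k hk => hy k (by omega), ?_⟩
      exact Submodule.mem_orthogonal_singleton_iff_inner_right.mpr (hy n (by omega))
  have hon : Orthonormal ℂ fun n => x (F n) := by
    refine ⟨fun n => hx2 _, ?_⟩
    intro i j hij
    rcases lt_or_gt_of_ne hij with h | h
    · exact hx1 (F j) _ (hmem h)
    · change ⟪_, _⟫_ℂ = 0
      rw [inner_eq_zero_symm]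
      exact hx1 (F i) _ (hmem h)
  have hval : ∀ n, (⟪S (x (F n)), x (F n)⟫_ℂ).re = m (F n) := by
    intro n
    rw [hx3, inner_smul_left, inner_self_eq_norm_sq_to_K, hx2]
    simp
  have hanti : Antitone fun n => m (F n) := antitone_nat_of_succ_le fun n => by
    have h := hx4 (F n) (x (F (n + 1)))
      (Submodule.orthogonal_le (hmono (Nat.le_succ n)) (hx1 (F (n + 1))))
    rw [hval, hx2] at h
    simpa using h
  refine ⟨fun n => x (F n), fun n => m (F n), hon, hanti, fun n => hm _, ?_, fun n => hx3 _,
    fun n y hy => hx4 _ y (hperp n y hy)⟩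
  have hbdd : BddBelow (range fun n => m (F n)) := ⟨0, by rintro _ ⟨n, rfl⟩; exact (hm _).le⟩
  have hlim := tendsto_atTop_ciInf hanti hbdd
  set L := ⨅ n, m (F n) with hL
  have hLle : ∀ n, L ≤ m (F n) := fun n => ciInf_le hbdd n
  have hL0 : 0 ≤ L := le_ciInf fun n => (hm _).le
  rcases hL0.eq_or_lt with h | hLpos
  · rw [h]; exact hlim
  exfalso
  -- a subsequence of `S eₙ` converges, although the distance of any two terms exceeds the limit
  obtain ⟨K, hK, hKs⟩ :=
    IsCompactOperator.image_closedBall_subset_compact (f := (S : H →ₗ[ℂ] H)) hc 1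
  have hin : ∀ n, S (x (F n)) ∈ K := fun n => hKs ⟨_, by simp [hx2], rfl⟩
  obtain ⟨a, -, φ, hφ, hconv⟩ := hK.tendsto_subseq hin
  have hcau := hconv.cauchySeq
  rw [Metric.cauchySeq_iff'] at hcau
  obtain ⟨N, hN⟩ := hcau L hLpos
  have h1 := hN (N + 1) (by omega)
  have hne : φ (N + 1) ≠ φ N := (hφ (Nat.lt_succ_self N)).ne'
  have h2 : ‖S (x (F (φ (N + 1)))) - S (x (F (φ N)))‖ ^ 2
      = m (F (φ (N + 1))) ^ 2 + m (F (φ N)) ^ 2 := by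
    rw [@norm_sub_sq ℂ, hx3, hx3, inner_smul_left, inner_smul_right, hon.2 hne, norm_smul,
      norm_smul, hx2, hx2]
    simp
  rw [dist_eq_norm] at h1
  simp only [Function.comp] at h1
  have h3 := hLle (φ N)
  have h4 : L ^ 2 ≤ m (F (φ N)) ^ 2 := by gcongr
  have h5 : ‖S (x (F (φ (N + 1)))) - S (x (F (φ N)))‖ ^ 2 < L ^ 2 := by gcongr
  nlinarith [sq_nonneg (m (F (φ (N + 1))))]

end Abstract

/-! ### The spectrum of a quadratic form -/

section FormSpectrum

variable {H : Type*} [NormedAddCommGroup H] [InnerProductSpace ℂ H]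
variable {W : Type*} [NormedAddCommGroup W] [InnerProductSpace ℂ W]

/-- The spectral decomposition of a quadratic form on a Hilbert space `H`. The form domain is the
Hilbert space `W`, mapped to `H` by `J`, and the form is `⟪A y, z⟫`. The `w n ∈ W` are eigenvectors
of the form with eigenvalues `lam n`, listed in increasing order, their images in `H` are a complete
orthonormal sequence, and `lam n` is the minimum of the Rayleigh quotient `⟪A y, y⟫ / ‖J y‖²` on
the orthogonal complement of the first `n` of them. -/
structure IsFormSpectrum (J : W →L[ℂ] H) (A : W →L[ℂ] W) (lam : ℕ → ℝ) (w : ℕ → W) : Prop where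
  monotone : Monotone lam
  tendsto : Tendsto lam atTop atTop
  orthonormal : Orthonormal ℂ fun n => J (w n)
  eigen : ∀ n y, ⟪A (w n), y⟫_ℂ = lam n * ⟪J (w n), J y⟫_ℂ
  le_form : ∀ n y, (∀ k < n, ⟪J (w k), J y⟫_ℂ = 0) → lam n * ‖J y‖ ^ 2 ≤ (⟪A y, y⟫_ℂ).re
  complete : ∀ f : H, (∀ k, ⟪J (w k), f⟫_ℂ = 0) → f = 0

/-- A form which is coercive up to a multiple of the norm of `H` has a complete sequence of
eigenvectors if its domain is compactly embedded: apply the spectral theorem to the resolvent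
`J (A + c J* J)⁻¹ J*`. -/
theorem exists_isFormSpectrum [CompleteSpace H] [CompleteSpace W] {J : W →L[ℂ] H} {A : W →L[ℂ] W}
    (hJ : IsCompactOperator J)
    (hJd : ∀ f : H, (∀ y, ⟪J y, f⟫_ℂ = 0) → f = 0) (hH : ¬ FiniteDimensional ℂ H)
    (hA : A.IsSymmetric) {c δ : ℝ} (hδ : 0 < δ)
    (hco : ∀ y, δ * ‖y‖ ^ 2 ≤ (⟪A y, y⟫_ℂ).re + c * ‖J y‖ ^ 2) :
    ∃ lam w, IsFormSpectrum J A lam w := by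
  let B : W →L[ℂ] W := A + (c : ℂ) • (J.adjoint ∘L J)
  have hBi : ∀ y z, ⟪B y, z⟫_ℂ = ⟪A y, z⟫_ℂ + c * ⟪J y, J z⟫_ℂ := by
    intro y z
    change ⟪A y + (c : ℂ) • J.adjoint (J y), z⟫_ℂ = _
    rw [inner_add_left, inner_smul_left, ContinuousLinearMap.adjoint_inner_left,
      Complex.conj_ofReal]
  have hBs : ∀ y z, ⟪B y, z⟫_ℂ = ⟪y, B z⟫_ℂ := by
    intro y z
    have h1 : ⟪A y, z⟫_ℂ = ⟪y, A z⟫_ℂ := hA y z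
    rw [← inner_conj_symm y (B z), hBi, hBi, map_add, map_mul, inner_conj_symm, inner_conj_symm,
      Complex.conj_ofReal, h1]
  have hBre : ∀ y, (⟪B y, y⟫_ℂ).re = (⟪A y, y⟫_ℂ).re + c * ‖J y‖ ^ 2 := by
    intro y
    rw [hBi, inner_self_eq_norm_sq_to_K, Complex.add_re, Complex.re_ofReal_mul]
    congr 2
    norm_cast
  have hBco : ∀ y, δ * ‖y‖ ^ 2 ≤ (⟪B y, y⟫_ℂ).re := fun y => (hco y).trans (hBre y).ge
  have hunit : IsUnit B := by
    refine ContinuousLinearMap.isUnit_of_forall_le_norm_inner_map B (c := ⟨δ, hδ.le⟩) hδ fun y => ?_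
    rw [mul_comm]
    exact (hBco y).trans (Complex.re_le_norm _)
  obtain ⟨u, hu⟩ := hunit
  let R : W →L[ℂ] W := ↑u⁻¹
  have hBR : ∀ y, B (R y) = y := by
    intro y
    have h : B * R = 1 := by rw [← hu]; exact u.mul_inv
    exact congrArg (fun T : W →L[ℂ] W => T y) h
  let S : H →L[ℂ] H := J ∘L (R ∘L J.adjoint)
  have hSi : ∀ f g, ⟪S f, g⟫_ℂ = ⟪R (J.adjoint f), B (R (J.adjoint g))⟫_ℂ := by
    intro f g
    rw [hBR, ContinuousLinearMap.adjoint_inner_right]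
    rfl
  have hS0 : ∀ f, (⟪S f, f⟫_ℂ).re = (⟪B (R (J.adjoint f)), R (J.adjoint f)⟫_ℂ).re := by
    intro f
    rw [hSi, hBs]
  have hSc : IsCompactOperator S := hJ.comp_clm _
  have hSs : S.IsSymmetric := by
    intro f g
    change ⟪S f, g⟫_ℂ = ⟪f, S g⟫_ℂ
    rw [← inner_conj_symm f (S g), hSi, hSi, inner_conj_symm, hBs]
  have hSpos : ∀ x, x ≠ 0 → 0 < (⟪S x, x⟫_ℂ).re := by
    intro f hf
    rw [hS0]
    refine lt_of_lt_of_le ?_ (hBco _)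
    have : R (J.adjoint f) ≠ 0 := by
      intro h0
      apply hf
      apply hJd
      intro y
      rw [← ContinuousLinearMap.adjoint_inner_right, ← hBR (J.adjoint f), h0, map_zero,
        inner_zero_right]
    have := norm_pos_iff.mpr this
    positivity
  obtain ⟨e, μ, he, hanti, hμ, hlim, heig, hmax⟩ := exists_antitone_eigenbasis hSc hSs hSpos hH
  have hJw : ∀ n, J (((μ n)⁻¹ : ℂ) • R (J.adjoint (e n))) = e n := by
    intro n
    have h1 : J (R (J.adjoint (e n))) = (μ n : ℂ) • e n := heig n
    have h2 : (μ n : ℂ) ≠ 0 := by exact_mod_cast (hμ n).ne'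
    rw [map_smul, h1, smul_smul, inv_mul_cancel₀ h2, one_smul]
  refine ⟨fun n => (μ n)⁻¹ - c, fun n => ((μ n)⁻¹ : ℂ) • R (J.adjoint (e n)),
    ?_, ?_, ?_, ?_, ?_, ?_⟩
  · intro m n hmn
    have := inv_anti₀ (hμ n) (hanti hmn)
    dsimp only
    linarith
  · refine tendsto_atTop_add_const_right _ (-c) ?_
    refine Tendsto.inv_tendsto_nhdsGT_zero ?_
    rw [tendsto_nhdsWithin_iff]
    exact ⟨hlim, Eventually.of_forall hμ⟩
  · simpa only [hJw] using he
  · intro n y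
    have h1 := hBi (((μ n)⁻¹ : ℂ) • R (J.adjoint (e n))) y
    rw [hJw, map_smul, hBR, inner_smul_left, ContinuousLinearMap.adjoint_inner_left, map_inv₀,
      Complex.conj_ofReal] at h1
    simp only [hJw]
    push_cast
    linear_combination -h1
  · intro n y hy
    simp only [hJw] at hy
    have h1 := hmax n (J y) hy
    rw [hS0] at h1
    -- expand the form at `y - μ⁻¹ v`, where `v = B⁻¹ J* J y`
    set v := R (J.adjoint (J y)) with hv
    have h2 : ⟪B y, v⟫_ℂ = (‖J y‖ ^ 2 : ℝ) := by
      rw [hBs, hv, hBR, ContinuousLinearMap.adjoint_inner_right, inner_self_eq_norm_sq_to_K]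
      norm_cast
    have h3 : ⟪B v, y⟫_ℂ = (‖J y‖ ^ 2 : ℝ) := by
      rw [hv, hBR, ContinuousLinearMap.adjoint_inner_left, inner_self_eq_norm_sq_to_K]
      norm_cast
    have h4 : 0 ≤ (⟪B (y - ((μ n)⁻¹ : ℝ) • v), y - ((μ n)⁻¹ : ℝ) • v⟫_ℂ).re :=
      le_trans (by positivity) (hBco _)
    have h5 : (((μ n)⁻¹ : ℝ) • v : W) = (((μ n)⁻¹ : ℝ) : ℂ) • v := rfl
    rw [h5, map_sub, map_smul, inner_sub_left, inner_sub_right, inner_sub_right, inner_smul_left,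
      inner_smul_left, inner_smul_right, inner_smul_right, h2, h3, Complex.conj_ofReal] at h4
    simp only [Complex.sub_re, Complex.re_ofReal_mul, Complex.ofReal_re] at h4
    rw [hBre y] at h4
    have h6 : (μ n)⁻¹ * ((μ n)⁻¹ * (⟪B v, v⟫_ℂ).re) ≤ (μ n)⁻¹ * ((μ n)⁻¹ * (μ n * ‖J y‖ ^ 2)) := by
      have := (hμ n).le
      gcongr
    rw [inv_mul_cancel_left₀ (hμ n).ne'] at h6
    nlinarith
  · intro f hf
    simp only [hJw] at hf
    by_contra hne
    have h1 : ∀ n, (⟪S f, f⟫_ℂ).re ≤ μ n * ‖f‖ ^ 2 := fun n => hmax n f fun k _ => hf k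
    have h2 := ge_of_tendsto' (hlim.mul_const (‖f‖ ^ 2)) h1
    rw [zero_mul] at h2
    exact absurd (hSpos f hne) (not_lt.mpr h2)

/-- The eigenvalues of a form enumerate the eigenvalues of the operator that it represents. -/
theorem IsFormSpectrum.isEigenvalueEnumeration {J : W →L[ℂ] H} {A : W →L[ℂ] W} {lam : ℕ → ℝ}
    {w : ℕ → W} (h : IsFormSpectrum J A lam w) (hA : A.IsSymmetric) {T : H →ₗ.[ℂ] H}
    (hT : ∀ (z : ℂ) (f : H), f ∈ eigenspace T z ↔
      ∃ u, J u = f ∧ ∀ y, ⟪A u, y⟫_ℂ = conj z * ⟪J u, J y⟫_ℂ) :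
    IsEigenvalueEnumeration T lam := by
  have hfin : ∀ z : ℂ, {n | (lam n : ℂ) = z}.Finite := by
    intro z
    have h1 : ∀ᶠ n in atTop, z.re < lam n := h.tendsto.eventually_gt_atTop z.re
    obtain ⟨N, hN⟩ := eventually_atTop.mp h1
    refine (finite_lt_nat N).subset fun n hn => ?_
    by_contra hc
    have h2 := hN n (not_lt.mp hc)
    have h3 : (lam n : ℂ) = z := hn
    rw [← h3, Complex.ofReal_re] at h2
    exact lt_irrefl _ h2
  have hspan : ∀ z : ℂ, eigenspace T z
      = Submodule.span ℂ (range fun n : {n | (lam n : ℂ) = z} => J (w n)) := by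
    intro z
    apply le_antisymm
    · intro f hf
      obtain ⟨u, rfl, hu⟩ := (hT z f).mp hf
      have hz : ∀ k, (lam k : ℂ) ≠ z → ⟪J (w k), J u⟫_ℂ = 0 := by
        intro k hk
        have h1 := h.eigen k u
        have h2 := hu (w k)
        have h3 : ⟪A u, w k⟫_ℂ = ⟪u, A (w k)⟫_ℂ := hA u (w k)
        rw [h3, ← inner_conj_symm, h1, ← inner_conj_symm (J u), ← map_mul] at h2
        have h4 := (starRingEnd ℂ).injective h2
        have h5 : ((lam k : ℂ) - z) * ⟪J (w k), J u⟫_ℂ = 0 := by linear_combination h4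
        exact (mul_eq_zero.mp h5).resolve_left (sub_ne_zero.mpr hk)
      let s := (hfin z).toFinset
      have h0 : J u - ∑ k ∈ s, ⟪J (w k), J u⟫_ℂ • J (w k) = 0 := by
        apply h.complete
        intro k
        rw [inner_sub_right, inner_sum]
        simp only [inner_smul_right]
        have hon := orthonormal_iff_ite.mp h.orthonormal
        simp only [hon]
        by_cases hk : k ∈ s
        · simp [hk]
        · simp [hk, hz k (by simpa [s] using hk)]
      rw [sub_eq_zero.mp h0]
      refine Submodule.sum_mem _ fun k hk => Submodule.smul_mem _ _ (Submodule.subset_span ?_)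
      exact ⟨⟨k, by simpa [s] using hk⟩, rfl⟩
    · rw [Submodule.span_le]
      rintro _ ⟨⟨n, hn⟩, rfl⟩
      refine (hT z _).mpr ⟨w n, rfl, fun y => ?_⟩
      have hn' : (lam n : ℂ) = z := hn
      rw [h.eigen, ← hn', Complex.conj_ofReal]
  refine ⟨h.monotone, fun z => ?_, fun z => ?_⟩
  · rw [hspan]
    have := (hfin z).to_subtype
    exact FiniteDimensional.span_of_finite ℂ (finite_range _)
  · have hf := hfin z
    have := hf.fintype
    have hli := h.orthonormal.linearIndependent.comp _
      (Subtype.val_injective : Function.Injective (Subtype.val : {n | (lam n : ℂ) = z} → ℕ))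
    rw [hspan]
    refine Eq.trans ?_ (congrArg _ (finrank_span_eq_card hli).symm)
    rw [Set.encard_eq_coe_toFinset_card, Set.toFinset_card]

end FormSpectrum

/-! ### Comparison of two forms -/

section Comparison

/-- A bound by a telescoping sum. -/
theorem sum_one_div_add_sq_le {D : ℝ} (hD : 1 < D) (n : ℕ) :
    ∑ j ∈ Finset.range n, 1 / ((j : ℝ) + D) ^ 2 ≤ 1 / (D - 1) - 1 / (n + D - 1) := by
  induction n with
  | zero => simp
  | succ n ih =>
    rw [Finset.sum_range_succ]
    have h1 : (0 : ℝ) < n + D - 1 := by have : (0 : ℝ) ≤ n := n.cast_nonneg; linarith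
    have h2 : (0 : ℝ) < n + D := by linarith
    have h3 : 1 / ((n : ℝ) + D) ^ 2 ≤ 1 / (n + D - 1) - 1 / (n + D) := by
      rw [div_sub_div _ _ h1.ne' h2.ne', div_le_div_iff₀ (by positivity) (by positivity)]
      nlinarith
    have h4 : ((n + 1 : ℕ) : ℝ) + D - 1 = n + D := by push_cast; ring
    rw [h4]
    linarith

theorem sum_range_mul_div (h : ℕ → ℝ) {N : ℕ} (hN : 0 < N) (n : ℕ) :
    ∑ m ∈ Finset.range (N * n), h (m / N) = N * ∑ j ∈ Finset.range n, h j := by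
  induction n with
  | zero => simp
  | succ n ih =>
    rw [Nat.mul_succ, Finset.sum_range_add, ih, Finset.sum_range_succ, mul_add]
    congr 1
    rw [Finset.sum_congr rfl (g := fun _ => h n)]
    · simp
    · intro i hi
      rw [Nat.mul_add_div hN, Nat.div_eq_of_lt (Finset.mem_range.mp hi), add_zero]

/-- If the `lam k` are spaced at least quadratically, then the sums `∑ 1 / (lam n - lam k + C)` over
`k ≤ n` are small, uniformly in `n`, for large `C`. -/
theorem exists_sum_one_div_le {lam : ℕ → ℝ} (hmono : Monotone lam) {N k₀ : ℕ} (hN : 0 < N) {ε : ℝ}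
    (hε : 0 < ε) (hsp : ∀ k, k₀ ≤ k → ∀ j : ℕ, ε * (j : ℝ) ^ 2 ≤ lam (k + j * N) - lam k) {η : ℝ}
    (hη : 0 < η) :
    ∃ C, 0 < C ∧ ∀ n, ∑ k ∈ Finset.range (n + 1), 1 / (lam n - lam k + C) ≤ η := by
  -- the first `k₀` terms are at most `1 / C` each, the others are grouped into blocks of length `N`
  -- and compared with a sum of inverse squares; both parts are at most of the order `1 / (D - 1)`
  set D : ℝ := 2 + (k₀ + 2 * N) / (ε * η) with hD
  have hD2 : 2 ≤ D := by rw [hD]; simp only [le_add_iff_nonneg_right]; positivity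
  have hD1 : 0 < D - 1 := by linarith
  set C : ℝ := ε * D ^ 2 with hC
  have hC0 : 0 < C := by positivity
  refine ⟨C, hC0, fun n => ?_⟩
  let h : ℕ → ℝ := fun j => 2 / ε * (1 / ((j : ℝ) + D) ^ 2)
  have hh0 : ∀ j, 0 ≤ h j := fun j => by positivity
  have hterm : ∀ k ∈ Finset.range (n + 1), 1 / (lam n - lam k + C)
      ≤ (if k < k₀ then 1 / C else 0) + h ((n - k) / N) := by
    intro k hk
    have hkn : k ≤ n := by have := Finset.mem_range.mp hk; omega
    have hle : 0 ≤ lam n - lam k := sub_nonneg.mpr (hmono hkn)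
    split_ifs with hkk
    · have h1 : 1 / (lam n - lam k + C) ≤ 1 / C := one_div_le_one_div_of_le hC0 (by linarith)
      linarith [hh0 ((n - k) / N)]
    · set j := (n - k) / N with hj
      have h1 : k + j * N ≤ n := by
        have h0 : j * N ≤ n - k := Nat.div_mul_le_self (n - k) N
        omega
      have h2 := hsp k (not_lt.mp hkk) j
      have h3 := hmono h1
      have h4 : ε / 2 * ((j : ℝ) + D) ^ 2 ≤ lam n - lam k + C := by
        nlinarith [mul_nonneg hε.le (sq_nonneg ((j : ℝ) - D))]
      have h5 : 0 < (j : ℝ) + D := by positivity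
      have h6 : h j = 1 / (ε / 2 * ((j : ℝ) + D) ^ 2) := by
        simp only [h]; field_simp
      rw [zero_add, h6]
      exact one_div_le_one_div_of_le (by positivity) h4
  have hfirst : ∑ k ∈ Finset.range (n + 1), (if k < k₀ then 1 / C else 0) ≤ k₀ * (1 / C) := by
    rw [← Finset.sum_filter, Finset.sum_const, nsmul_eq_mul]
    have h1 : ((Finset.range (n + 1)).filter (· < k₀)).card ≤ k₀ := by
      calc _ ≤ (Finset.range k₀).card := Finset.card_le_card fun k hk => by
            simp only [Finset.mem_filter] at hk; simpa using hk.2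
        _ = k₀ := Finset.card_range k₀
    gcongr
  have hsecond : ∑ k ∈ Finset.range (n + 1), h ((n - k) / N) ≤ N * (2 / ε * (1 / (D - 1))) := by
    have h1 := Finset.sum_range_reflect (fun m => h (m / N)) (n + 1)
    simp only [Nat.add_sub_cancel] at h1
    have h2 : ∑ m ∈ Finset.range (n + 1), h (m / N) ≤ ∑ m ∈ Finset.range (N * (n + 1)), h (m / N) :=
      Finset.sum_le_sum_of_subset_of_nonneg
        (Finset.range_mono (Nat.le_mul_of_pos_left _ hN)) fun _ _ _ => hh0 _
    have h0 : ∀ j ∈ Finset.range (n + 1), n + 1 - 1 - j = n - j := fun j _ => by omega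
    rw [h1]
    refine h2.trans ?_
    rw [sum_range_mul_div h hN, ← Finset.mul_sum]
    have h3 := sum_one_div_add_sq_le (D := D) (by linarith) (n + 1)
    have h4 : (0 : ℝ) ≤ 1 / (((n + 1 : ℕ) : ℝ) + D - 1) := by
      have : (0 : ℝ) ≤ ((n + 1 : ℕ) : ℝ) := Nat.cast_nonneg _
      apply div_nonneg zero_le_one; linarith
    gcongr
    linarith
  calc _ ≤ ∑ k ∈ Finset.range (n + 1), ((if k < k₀ then 1 / C else 0) + h ((n - k) / N)) :=
        Finset.sum_le_sum hterm
    _ ≤ k₀ * (1 / C) + N * (2 / ε * (1 / (D - 1))) := by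
        rw [Finset.sum_add_distrib]; exact add_le_add hfirst hsecond
    _ ≤ k₀ * (1 / (ε * (D - 1))) + N * (2 / ε * (1 / (D - 1))) := by
        gcongr
        rw [hC]
        gcongr
        nlinarith
    _ = (k₀ + 2 * N) / (ε * (D - 1)) := by field_simp
    _ ≤ η := by
        rw [div_le_iff₀ (by positivity)]
        have h1 : (k₀ + 2 * N) / (ε * η) ≤ D - 1 := by rw [hD]; linarith
        rw [div_le_iff₀ (by positivity)] at h1
        linarith

variable {H : Type*} [NormedAddCommGroup H] [InnerProductSpace ℂ H]
variable {W : Type*} [NormedAddCommGroup W] [InnerProductSpace ℂ W]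
variable {X : Type*} [NormedAddCommGroup X] [NormedSpace ℂ X]

/-- Two forms which differ by a bounded form and by the square of the seminorm `‖P y‖` have
eigenvalues at a bounded one-sided distance, provided that `P` is bounded on the normalised
eigenvectors of the first form and that its eigenvalues are spaced at least quadratically. The test
space of the min-max principle is the span of the first `n + 1` eigenvectors; on it the perturbation
is compensated by the gaps `lam n - lam k`, because of the Cauchy-Schwarz inequality with weights
`lam n - lam k + C`. -/
theorem IsFormSpectrum.exists_le_add {J : W →L[ℂ] H} {A A' : W →L[ℂ] W} {lam lam' : ℕ → ℝ}
    {w w' : ℕ → W} (h : IsFormSpectrum J A lam w) (h' : IsFormSpectrum J A' lam' w')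
    {P : W →L[ℂ] X} {M s K : ℝ} (hs : 0 ≤ s)
    (hAA' : ∀ y, (⟪A' y, y⟫_ℂ).re ≤ (⟪A y, y⟫_ℂ).re + M * ‖J y‖ ^ 2 + s * ‖P y‖ ^ 2)
    (hK : ∀ k, ‖P (w k)‖ ^ 2 ≤ K) {N k₀ : ℕ} (hN : 0 < N) {ε : ℝ} (hε : 0 < ε)
    (hsp : ∀ k, k₀ ≤ k → ∀ j : ℕ, ε * (j : ℝ) ^ 2 ≤ lam (k + j * N) - lam k) :
    ∃ C, ∀ n, lam' n ≤ lam n + C := by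
  have hK0 : 0 ≤ K := (sq_nonneg _).trans (hK 0)
  obtain ⟨C, hC0, hC⟩ := exists_sum_one_div_le h.monotone hN hε hsp
    (η := 1 / (s * K + 1)) (by positivity)
  refine ⟨M + C, fun n => ?_⟩
  -- a combination `y` of `w 0, …, w n` that is orthogonal to the first `n` eigenvectors of `A'`
  let L : (Fin (n + 1) → ℂ) →ₗ[ℂ] (Fin n → ℂ) :=
    Matrix.mulVecLin (Matrix.of fun k i => ⟪J (w' k), J (w i)⟫_ℂ)
  have hker : LinearMap.ker L ≠ ⊥ := LinearMap.ker_ne_bot_of_finrank_lt (by simp)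
  obtain ⟨c, hc, hc0⟩ := Submodule.exists_mem_ne_zero_of_ne_bot hker
  set y : W := ∑ i, c i • w i with hy
  have hJy : J y = ∑ i, c i • J (w i) := by rw [hy, map_sum]; simp only [map_smul]
  have hon := orthonormal_iff_ite.mp h.orthonormal
  have hcoef : ∀ i : Fin (n + 1), ⟪J (w i), J y⟫_ℂ = c i := by
    intro i
    rw [hJy, inner_sum]
    simp only [inner_smul_right, hon, Fin.val_inj]
    simp
  have hperp : ∀ k < n, ⟪J (w' k), J y⟫_ℂ = 0 := by
    intro k hk
    have h1 := congrFun (LinearMap.mem_ker.mp hc) ⟨k, hk⟩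
    rw [hJy, inner_sum]
    simp only [inner_smul_right]
    simp only [L, Matrix.mulVecLin_apply, Matrix.mulVec, dotProduct, Matrix.of_apply,
      Pi.zero_apply] at h1
    rw [← h1]
    exact Finset.sum_congr rfl fun i _ => mul_comm _ _
  have hnorm : ‖J y‖ ^ 2 = ∑ i, ‖c i‖ ^ 2 := by
    have h1 : ⟪J y, J y⟫_ℂ = ((∑ i, ‖c i‖ ^ 2 : ℝ) : ℂ) := by
      nth_rewrite 1 [hJy]
      rw [sum_inner]
      simp only [inner_smul_left, hcoef, Complex.conj_mul']
      push_cast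
      rfl
    exact Complex.ofReal_injective (Eq.trans (by rw [inner_self_eq_norm_sq_to_K]; norm_cast) h1)
  have hform : (⟪A y, y⟫_ℂ).re = ∑ i : Fin (n + 1), lam i * ‖c i‖ ^ 2 := by
    have h1 : ⟪A y, y⟫_ℂ = ((∑ i : Fin (n + 1), lam i * ‖c i‖ ^ 2 : ℝ) : ℂ) := by
      have h2 : A y = ∑ i, c i • A (w i) := by rw [hy, map_sum]; simp only [map_smul]
      rw [h2, sum_inner]
      push_cast
      refine Finset.sum_congr rfl fun i _ => ?_
      rw [inner_smul_left, h.eigen, hcoef, mul_left_comm, Complex.conj_mul']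
    rw [h1, Complex.ofReal_re]
  set d : Fin (n + 1) → ℝ := fun i => lam n - lam i + C with hd
  have hd0 : ∀ i, 0 < d i := fun i => by
    have : lam i ≤ lam n := h.monotone (by omega)
    simp only [hd]; linarith
  have hP : ‖P y‖ ^ 2 ≤ (∑ i, d i * ‖c i‖ ^ 2) * ∑ i, K * (1 / d i) := by
    have h1 : ‖P y‖ ≤ ∑ i : Fin (n + 1), ‖c i‖ * ‖P (w i)‖ := by
      rw [hy, map_sum]
      refine (norm_sum_le _ _).trans (Finset.sum_le_sum fun i _ => ?_)
      rw [map_smul, norm_smul]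
    have h2 : (∑ i : Fin (n + 1), ‖c i‖ * ‖P (w i)‖) ^ 2
        ≤ (∑ i, d i * ‖c i‖ ^ 2) * ∑ i : Fin (n + 1), ‖P (w i)‖ ^ 2 * (1 / d i) := by
      refine Finset.sum_sq_le_sum_mul_sum_of_sq_le_mul _ (fun i _ => ?_) (fun i _ => ?_)
        fun i _ => ?_
      · have := hd0 i; positivity
      · have := hd0 i; positivity
      · have := (hd0 i).ne'
        refine le_of_eq ?_
        field_simp
    calc ‖P y‖ ^ 2 ≤ (∑ i : Fin (n + 1), ‖c i‖ * ‖P (w i)‖) ^ 2 := by gcongr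
      _ ≤ _ := h2
      _ ≤ _ := by
        refine mul_le_mul_of_nonneg_left (Finset.sum_le_sum fun i _ => ?_)
          (Finset.sum_nonneg fun i _ => ?_)
        · have := hd0 i
          exact mul_le_mul_of_nonneg_right (hK i) (by positivity)
        · have := hd0 i; positivity
  have hdsum : ∑ i, d i * ‖c i‖ ^ 2
      = (lam n + C) * ‖J y‖ ^ 2 - ∑ i : Fin (n + 1), lam i * ‖c i‖ ^ 2 := by
    rw [hnorm, Finset.mul_sum, ← Finset.sum_sub_distrib]
    exact Finset.sum_congr rfl fun i _ => by simp only [hd]; ring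
  have hdpos : 0 ≤ ∑ i, d i * ‖c i‖ ^ 2 := Finset.sum_nonneg fun i _ => by
    have := hd0 i; positivity
  have hsK : s * ∑ i, K * (1 / d i) ≤ 1 := by
    have h1 := hC n
    rw [Finset.sum_range] at h1
    rw [← Finset.mul_sum, ← mul_assoc]
    calc s * K * ∑ i, 1 / d i ≤ s * K * (1 / (s * K + 1)) := by gcongr
      _ ≤ 1 := by
        rw [mul_one_div, div_le_one (by positivity)]
        linarith
  have hy0 : 0 < ‖J y‖ ^ 2 := by
    rw [hnorm]
    obtain ⟨i, hi⟩ := Function.ne_iff.mp hc0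
    refine Finset.sum_pos' (fun i _ => by positivity) ⟨i, Finset.mem_univ _, ?_⟩
    have := norm_pos_iff.mpr hi
    positivity
  have h1 := h'.le_form n y hperp
  have h2 := hAA' y
  have h3 : s * ‖P y‖ ^ 2 ≤ ∑ i, d i * ‖c i‖ ^ 2 :=
    calc s * ‖P y‖ ^ 2 ≤ s * ((∑ i, d i * ‖c i‖ ^ 2) * ∑ i, K * (1 / d i)) := by gcongr
      _ = (∑ i, d i * ‖c i‖ ^ 2) * (s * ∑ i, K * (1 / d i)) := by ring
      _ ≤ _ := mul_le_of_le_one_right hdpos hsK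
  refine le_of_mul_le_mul_right ?_ hy0
  rw [hform] at h2
  linarith

end Comparison

/-! ### Absolutely continuous functions -/

section Primitive

/-- `u` is absolutely continuous on `[0, l]` with derivative `w`: it is the indefinite integral of
the integrable function `w`. -/
def IsPrimitiveOn (l : ℝ) (u w : ℝ → ℂ) : Prop :=
  IntervalIntegrable w volume 0 l ∧ ∀ x ∈ Icc 0 l, u x = u 0 + ∫ t in (0 : ℝ)..x, w t

variable {l : ℝ} {u w u' w' : ℝ → ℂ}

theorem absolutelyContinuousOnInterval_integral (hl : 0 ≤ l) (hw : IntervalIntegrable w volume 0 l)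
    (c : ℂ) : AbsolutelyContinuousOnInterval (fun x => c + ∫ t in (0 : ℝ)..x, w t) 0 l := by
  have hofReal : ∀ {r : ℝ → ℝ}, AbsolutelyContinuousOnInterval r 0 l →
      AbsolutelyContinuousOnInterval (fun x => (r x : ℂ)) 0 l := by
    intro r hr
    simpa only [AbsolutelyContinuousOnInterval, Complex.dist_eq, ← Complex.ofReal_sub,
      Complex.norm_real, Real.norm_eq_abs, Real.dist_eq] using hr
  have hre : IntervalIntegrable (fun x => (w x).re) volume 0 l := ⟨hw.1.re, hw.2.re⟩
  have him : IntervalIntegrable (fun x => (w x).im) volume 0 l := ⟨hw.1.im, hw.2.im⟩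
  have h1 := hofReal (hre.absolutelyContinuousOnInterval_intervalIntegral (c := 0) left_mem_uIcc)
  have h2 := hofReal (him.absolutelyContinuousOnInterval_intervalIntegral (c := 0) left_mem_uIcc)
  have h3 : AbsolutelyContinuousOnInterval (fun _ : ℝ => c) 0 l := by
    simp [AbsolutelyContinuousOnInterval, tendsto_const_nhds]
  have h4 := h3.fun_add (h1.fun_add (h2.const_smul Complex.I))
  refine Tendsto.congr' ?_ h4
  rw [EventuallyEq, eventually_inf_principal]
  refine Eventually.of_forall fun E hE => Finset.sum_congr rfl fun i hi => ?_
  have hint : ∀ x ∈ uIcc (0 : ℝ) l, ((∫ t in (0 : ℝ)..x, (w t).re : ℝ) : ℂ)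
      + Complex.I • ((∫ t in (0 : ℝ)..x, (w t).im : ℝ) : ℂ) = ∫ t in (0 : ℝ)..x, w t := by
    intro x hx
    have hwx : IntervalIntegrable w volume 0 x :=
      hw.mono_set (uIcc_subset_uIcc left_mem_uIcc hx)
    rw [uIcc_of_le hl] at hx
    rw [intervalIntegral.integral_of_le hx.1, intervalIntegral.integral_of_le hx.1,
      intervalIntegral.integral_of_le hx.1]
    have h5 := integral_re_add_im (𝕜 := ℂ) hwx.1
    rw [← h5, smul_eq_mul, mul_comm]
    rfl
  have hm := hE.1 i hi
  simp only [hint _ hm.1, hint _ hm.2]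

theorem IsPrimitiveOn.continuousOn (hl : 0 ≤ l) (h : IsPrimitiveOn l u w) :
    ContinuousOn u (Icc 0 l) := by
  have h1 := (absolutelyContinuousOnInterval_integral hl h.1 (u 0)).continuousOn
  rw [uIcc_of_le hl] at h1
  exact h1.congr h.2

/-- The product rule for absolutely continuous functions. -/
theorem IsPrimitiveOn.mul (hl : 0 ≤ l) (h : IsPrimitiveOn l u w) (h' : IsPrimitiveOn l u' w') :
    IsPrimitiveOn l (fun x => u x * u' x) (fun x => w x * u' x + u x * w' x) := by
  have hc := h.continuousOn hl
  have hc' := h'.continuousOn hl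
  rw [← uIcc_of_le hl] at hc hc'
  have hint : IntervalIntegrable (fun x => w x * u' x + u x * w' x) volume 0 l :=
    (h.1.mul_continuousOn hc').add (h'.1.continuousOn_mul hc)
  refine ⟨hint, ?_⟩
  have ha := absolutelyContinuousOnInterval_integral hl h.1 (u 0)
  have ha' := absolutelyContinuousOnInterval_integral hl h'.1 (u' 0)
  have hm := (ha.fun_smul ha').fun_sub (absolutelyContinuousOnInterval_integral hl hint 0)
  -- the difference of the two sides is absolutely continuous with vanishing derivative
  obtain ⟨C, hC⟩ := hm.const_of_ae_hasDerivAt_zero (by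
    filter_upwards [h.1.ae_hasDerivAt_integral, h'.1.ae_hasDerivAt_integral,
      hint.ae_hasDerivAt_integral] with x h1 h2 h3 hx
    have e1 := (h1 hx 0 left_mem_uIcc).const_add (u 0)
    have e2 := (h2 hx 0 left_mem_uIcc).const_add (u' 0)
    have e3 := (h3 hx 0 left_mem_uIcc).const_add (0 : ℂ)
    have hx' : x ∈ Icc 0 l := by rwa [uIcc_of_le hl] at hx
    have e4 := (e1.smul e2).sub e3
    rw [← h.2 x hx', ← h'.2 x hx', show u x • w' x + w x • u' x - (w x * u' x + u x * w' x) = 0 by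
      rw [smul_eq_mul, smul_eq_mul]; ring] at e4
    exact e4)
  intro x hx
  have hx1 := hC x (by rwa [uIcc_of_le hl])
  have hx0 := hC 0 left_mem_uIcc
  simp only [smul_eq_mul, intervalIntegral.integral_same, add_zero, sub_zero, zero_add] at hx0 hx1
  rw [← h.2 x hx, ← h'.2 x hx] at hx1
  beta_reduce
  rw [hx0, ← hx1]
  ring

theorem IsPrimitiveOn.conj (h : IsPrimitiveOn l u w) :
    IsPrimitiveOn l (fun x => conj (u x)) (fun x => conj (w x)) := by
  refine ⟨?_, fun x hx => ?_⟩
  · exact ⟨Complex.conjCLE.integrable_comp_iff.mpr h.1.1,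
      Complex.conjCLE.integrable_comp_iff.mpr h.1.2⟩
  · beta_reduce
    rw [h.2 x hx, map_add, intervalIntegral.integral_of_le hx.1,
      intervalIntegral.integral_of_le hx.1, ← integral_conj]

theorem IsPrimitiveOn.add (hl : 0 ≤ l) (h : IsPrimitiveOn l u w) (h' : IsPrimitiveOn l u' w') :
    IsPrimitiveOn l (fun x => u x + u' x) (fun x => w x + w' x) := by
  refine ⟨h.1.add h'.1, fun x hx => ?_⟩
  have hs : uIcc 0 x ⊆ uIcc 0 l :=
    uIcc_subset_uIcc left_mem_uIcc (by rwa [uIcc_of_le hl])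
  beta_reduce
  rw [h.2 x hx, h'.2 x hx, intervalIntegral.integral_add (h.1.mono_set hs) (h'.1.mono_set hs)]
  ring

theorem IsPrimitiveOn.const_mul (h : IsPrimitiveOn l u w) (c : ℂ) :
    IsPrimitiveOn l (fun x => c * u x) (fun x => c * w x) := by
  refine ⟨h.1.const_mul c, fun x hx => ?_⟩
  beta_reduce
  rw [h.2 x hx, intervalIntegral.integral_const_mul]
  ring

theorem IsPrimitiveOn.congr_deriv (hl : 0 ≤ l) (h : IsPrimitiveOn l u w)
    (hw : ∀ᵐ x ∂volume.restrict (Ioo (0 : ℝ) l), w x = w' x) : IsPrimitiveOn l u w' := by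
  have hw1 : ∀ᵐ x ∂volume.restrict (Ioc (0 : ℝ) l), w x = w' x := by
    rwa [← Measure.restrict_congr_set Ioo_ae_eq_Ioc]
  refine ⟨?_, fun x hx => ?_⟩
  · rw [intervalIntegrable_iff_integrableOn_Ioc_of_le hl]
    have h1 := h.1
    rw [intervalIntegrable_iff_integrableOn_Ioc_of_le hl] at h1
    exact Integrable.congr h1 hw1
  · rw [h.2 x hx, intervalIntegral.integral_of_le hx.1, intervalIntegral.integral_of_le hx.1]
    congr 1
    apply integral_congr_ae
    exact ae_mono (Measure.restrict_mono (Ioc_subset_Ioc_right hx.2) le_rfl) hw1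

theorem isPrimitiveOn_of_contDiff {φ : ℝ → ℝ} (hφ : ContDiff ℝ ∞ φ) :
    IsPrimitiveOn l (fun x => (φ x : ℂ)) (fun x => ((deriv φ x : ℝ) : ℂ)) := by
  have hd : Continuous (deriv φ) := hφ.continuous_deriv (by simp)
  refine ⟨(Complex.continuous_ofReal.comp hd).intervalIntegrable _ _, fun x _ => ?_⟩
  rw [intervalIntegral.integral_ofReal, intervalIntegral.integral_deriv_eq_sub
    (fun y _ => (hφ.differentiable (by simp)).differentiableAt) (hd.intervalIntegrable _ _)]
  push_cast
  ring

/-- Integration by parts on `[0, l]`. -/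
theorem IsPrimitiveOn.integral_mul_add_mul (hl : 0 ≤ l) (h : IsPrimitiveOn l u w)
    (h' : IsPrimitiveOn l u' w') :
    ∫ x in Ioo 0 l, (w x * u' x + u x * w' x) = u l * u' l - u 0 * u' 0 := by
  have h1 := (h.mul hl h').2 l ⟨hl, le_rfl⟩
  beta_reduce at h1
  rw [h1, intervalIntegral.integral_of_le hl, integral_Ioc_eq_integral_Ioo]
  ring

/-- The oscillation of an absolutely continuous function is at most the `L¹`-norm of its
derivative. -/
theorem IsPrimitiveOn.norm_sub_le (h : IsPrimitiveOn l u w) {x y : ℝ} (hx : x ∈ Icc 0 l)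
    (hy : y ∈ Icc 0 l) : ‖u x - u y‖ ≤ ∫ t in Ioo 0 l, ‖w t‖ := by
  have hl : 0 ≤ l := hx.1.trans hx.2
  have hs : ∀ {z}, z ∈ Icc 0 l → IntervalIntegrable w volume 0 z := fun hz =>
    h.1.mono_set (uIcc_subset_uIcc left_mem_uIcc (by rwa [uIcc_of_le hl]))
  rw [h.2 x hx, h.2 y hy, add_sub_add_left_eq_sub,
    intervalIntegral.integral_interval_sub_left (hs hx) (hs hy)]
  refine intervalIntegral.norm_integral_le_integral_norm_uIoc.trans ?_
  rw [← integral_Ioc_eq_integral_Ioo]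
  have h1 := h.1
  rw [intervalIntegrable_iff_integrableOn_Ioc_of_le hl] at h1
  refine setIntegral_mono_set h1.norm (ae_of_all _ fun _ => norm_nonneg _) ?_
  refine LE.le.eventuallyLE fun t ht => ?_
  rw [uIoc, mem_Ioc] at ht
  exact ⟨lt_of_le_of_lt (le_min hy.1 hx.1) ht.1, ht.2.trans (max_le hy.2 hx.2)⟩

/-- The mean value of an absolutely continuous function differs from each of its values by at most
the `L¹`-norm of its derivative. -/
theorem IsPrimitiveOn.norm_integral_sub_le (h : IsPrimitiveOn l u w) {y : ℝ} (hy : y ∈ Icc 0 l) :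
    ‖(∫ x in Ioo 0 l, u x) - l * u y‖ ≤ l * ∫ t in Ioo 0 l, ‖w t‖ := by
  have hl : 0 ≤ l := hy.1.trans hy.2
  have hi : IntegrableOn u (Ioo 0 l) :=
    ((h.continuousOn hl).integrableOn_compact isCompact_Icc).mono_set Ioo_subset_Icc_self
  have h1 : (∫ x in Ioo 0 l, u x) - l * u y = ∫ x in Ioo 0 l, (u x - u y) := by
    rw [integral_sub hi (by simp), setIntegral_const]
    simp [hl]
  rw [h1]
  refine (norm_setIntegral_le_of_norm_le_const (by simp) fun x hx =>
    h.norm_sub_le (Ioo_subset_Icc_self hx) hy).trans (le_of_eq ?_)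
  simp [hl, mul_comm]

end Primitive

/-! ### Primitives in `L²(0, l)` -/

section IntervalSpace

variable {l : ℝ}

theorem intervalIntegrable_coeFn (hl : 0 ≤ l) (w : IntervalL2 l) :
    IntervalIntegrable w volume 0 l := by
  rw [intervalIntegrable_iff_integrableOn_Ioo_of_le hl]
  exact (Lp.memLp w).integrable (by norm_num)

/-- Integration over `(y, x)`, as a functional on `L²(0, l)`. -/
def integralL (l y x : ℝ) : IntervalL2 l →L[ℂ] ℂ :=
  innerSL ℂ (indicatorConstLp 2 (μ := volume.restrict (Ioo (0 : ℝ) l))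
    (measurableSet_Ioc (a := y) (b := x)) (measure_ne_top _ _) (1 : ℂ))

theorem integralL_apply {y x : ℝ} (hy : 0 ≤ y) (hyx : y ≤ x) (hx : x ≤ l) (w : IntervalL2 l) :
    integralL l y x w = ∫ t in y..x, w t := by
  rw [integralL, innerSL_apply_apply, L2.inner_indicatorConstLp_one,
    intervalIntegral.integral_of_le hyx]
  have h : (volume.restrict (Ioo (0 : ℝ) l)).restrict (Ioc y x) = volume.restrict (Ioc y x) := by
    rw [Measure.restrict_congr_set Ioo_ae_eq_Ioc, Measure.restrict_restrict measurableSet_Ioc,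
      inter_eq_left.mpr (Ioc_subset_Ioc hy hx)]
  rw [h]

theorem norm_integralL_le {y x : ℝ} (hyx : y ≤ x) : ‖integralL l y x‖ ≤ √(x - y) := by
  rw [integralL, innerSL_apply_norm, norm_indicatorConstLp (by norm_num) (by norm_num), norm_one,
    one_mul, Real.sqrt_eq_rpow, ENNReal.toReal_ofNat]
  refine Real.rpow_le_rpow measureReal_nonneg ?_ (by norm_num)
  have h : volume.restrict (Ioo (0 : ℝ) l) (Ioc y x) ≤ ENNReal.ofReal (x - y) := by
    rw [← Real.volume_Ioc]
    exact Measure.restrict_apply_le _ _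
  exact ENNReal.toReal_le_of_le_ofReal (sub_nonneg.mpr hyx) h

theorem norm_integral_le {y x : ℝ} (hy : 0 ≤ y) (hyx : y ≤ x) (hx : x ≤ l) (w : IntervalL2 l) :
    ‖∫ t in y..x, w t‖ ≤ √(x - y) * ‖w‖ := by
  rw [← integralL_apply hy hyx hx]
  exact ((integralL l y x).le_opNorm w).trans
    (mul_le_mul_of_nonneg_right (norm_integralL_le hyx) (norm_nonneg _))

theorem norm_integralL_apply_le {x : ℝ} (hx : x ∈ Ioo 0 l) (w : IntervalL2 l) :
    ‖integralL l 0 x w‖ ≤ √l * ‖w‖ := by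
  rw [integralL_apply le_rfl hx.1.le hx.2.le]
  refine (norm_integral_le le_rfl hx.1.le hx.2.le w).trans ?_
  have : x - 0 ≤ l := by linarith [hx.2]
  gcongr

theorem memLp_integralL (w : IntervalL2 l) :
    MemLp (fun x => integralL l 0 x w) 2 (volume.restrict (Ioo (0 : ℝ) l)) := by
  refine MemLp.of_bound ?_ (√l * ‖w‖) ?_
  · refine ContinuousOn.aestronglyMeasurable ?_ measurableSet_Ioo
    by_cases hl : 0 ≤ l
    · have h := (absolutelyContinuousOnInterval_integral hl
        (intervalIntegrable_coeFn hl w) 0).continuousOn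
      rw [uIcc_of_le hl] at h
      refine (h.mono Ioo_subset_Icc_self).congr fun x hx => ?_
      rw [integralL_apply le_rfl hx.1.le hx.2.le]
      exact (zero_add _).symm
    · intro x hx
      exact absurd (hx.1.trans hx.2).le hl
  · rw [ae_restrict_iff' measurableSet_Ioo]
    exact Eventually.of_forall fun x hx => norm_integralL_apply_le hx w

/-- The Volterra operator `w ↦ ∫₀ˣ w` on `L²(0, l)`. -/
def volterra (l : ℝ) : IntervalL2 l →L[ℂ] IntervalL2 l :=
  LinearMap.mkContinuous
    { toFun := fun w => (memLp_integralL w).toLp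
      map_add' := fun u v => by
        rw [← MemLp.toLp_add]
        exact MemLp.toLp_congr _ _ (Eventually.of_forall fun x => map_add _ u v)
      map_smul' := fun c u => by
        rw [RingHom.id_apply, ← MemLp.toLp_const_smul]
        exact MemLp.toLp_congr _ _ (Eventually.of_forall fun x => map_smul _ c u) }
    ((measureUnivNNReal (volume.restrict (Ioo (0 : ℝ) l)) : ℝ) ^ (2 : ENNReal).toReal⁻¹ * √l)
    (fun w => by
      rw [mul_assoc]
      refine Lp.norm_le_of_ae_bound (by positivity) ?_
      have h1 := (memLp_integralL w).coeFn_toLp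
      have h2 : ∀ᵐ x ∂volume.restrict (Ioo (0 : ℝ) l), x ∈ Ioo 0 l :=
        ae_restrict_mem measurableSet_Ioo
      filter_upwards [h1, h2] with x hx hxm
      change ‖(memLp_integralL w).toLp _ x‖ ≤ _
      rw [hx]
      exact norm_integralL_apply_le hxm w)

theorem volterra_coeFn (w : IntervalL2 l) :
    ∀ᵐ x ∂volume.restrict (Ioo (0 : ℝ) l), volterra l w x = integralL l 0 x w :=
  (memLp_integralL w).coeFn_toLp

theorem memLp_step (l : ℝ) (N : ℕ) (c : Fin (N + 1) → ℂ) :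
    MemLp (fun x : ℝ => c (Fin.ofNat (N + 1) ⌊x * (N + 1) / l⌋₊)) 2
      (volume.restrict (Ioo (0 : ℝ) l)) := by
  refine MemLp.of_bound ?_ ‖c‖ (Eventually.of_forall fun x => norm_le_pi_norm c _)
  refine Measurable.aestronglyMeasurable ?_
  have h1 : Measurable fun n : ℕ => c (Fin.ofNat (N + 1) n) := measurable_from_top
  exact h1.comp (Nat.measurable_floor.comp (by fun_prop))

/-- The step function on `(0, l)` with prescribed values on `N + 1` subintervals of equal length. -/
def stepFun (l : ℝ) (N : ℕ) : (Fin (N + 1) → ℂ) →ₗ[ℂ] IntervalL2 l where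
  toFun c := (memLp_step l N c).toLp
  map_add' _ _ := rfl
  map_smul' _ _ := rfl

/-- The Volterra operator is the norm limit of the operators of finite rank that replace the
indefinite integral by its values at equidistant points. -/
theorem isCompactOperator_volterra (hl : 0 < l) : IsCompactOperator (volterra l) := by
  let F : ℕ → IntervalL2 l →L[ℂ] IntervalL2 l := fun N =>
    (LinearMap.toContinuousLinearMap (stepFun l N)) ∘L
      ContinuousLinearMap.pi fun k : Fin (N + 1) => integralL l 0 (k * l / (N + 1))
  have hF : ∀ N, IsCompactOperator (F N) := fun N =>
    (isCompactOperator_of_locallyCompactSpace_rng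
      (LinearMap.toContinuousLinearMap (stepFun l N))).comp_clm _
  set K : ℝ := (measureUnivNNReal (volume.restrict (Ioo (0 : ℝ) l)) : ℝ) ^ (2 : ENNReal).toReal⁻¹
  have hbound : ∀ N, ‖F N - volterra l‖ ≤ K * √(l / (N + 1)) := by
    intro N
    refine ContinuousLinearMap.opNorm_le_bound _ (by positivity) fun w => ?_
    rw [mul_assoc]
    refine Lp.norm_le_of_ae_bound (by positivity) ?_
    have h2 : ∀ᵐ x ∂volume.restrict (Ioo (0 : ℝ) l), x ∈ Ioo 0 l :=
      ae_restrict_mem measurableSet_Ioo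
    have h3 : ∀ᵐ x ∂volume.restrict (Ioo (0 : ℝ) l), F N w x
        = integralL l 0
          (((Fin.ofNat (N + 1) ⌊x * (N + 1) / l⌋₊ : Fin (N + 1)) : ℕ) * l / (N + 1)) w :=
      (memLp_step l N _).coeFn_toLp
    filter_upwards [volterra_coeFn w, h2, h3, Lp.coeFn_sub (F N w) (volterra l w)]
      with x h4 hx h5 h6
    rw [show (F N - volterra l) w = F N w - volterra l w from rfl, h6, Pi.sub_apply, h4, h5]
    set k := ⌊x * (N + 1) / l⌋₊ with hk
    have hN : (0 : ℝ) < N + 1 := by positivity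
    have hxN : 0 ≤ x * (N + 1) / l := by have := hx.1; positivity
    have hk1 : k < N + 1 := by
      rw [hk, Nat.floor_lt hxN, div_lt_iff₀ hl]
      push_cast
      nlinarith [hx.2]
    have hk2 : ((Fin.ofNat (N + 1) k : Fin (N + 1)) : ℕ) = k := by
      simp [Fin.ofNat, Nat.mod_eq_of_lt hk1]
    rw [hk2]
    have hk3 : (k : ℝ) ≤ x * (N + 1) / l := Nat.floor_le hxN
    have hk4 : x * (N + 1) / l < k + 1 := Nat.lt_floor_add_one _
    have hk5 : k * l / (N + 1) ≤ x := by
      rw [div_le_iff₀ hN]; rwa [le_div_iff₀ hl] at hk3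
    have hk6 : x - k * l / (N + 1) ≤ l / (N + 1) := by
      rw [sub_le_iff_le_add, ← add_div, le_div_iff₀ hN]
      rw [div_lt_iff₀ hl] at hk4
      linarith
    have hk7 : 0 ≤ k * l / (N + 1) := by positivity
    have hii : ∀ z ∈ Icc 0 l, IntervalIntegrable w volume 0 z := fun z hz =>
      (intervalIntegrable_coeFn hl.le w).mono_set
        (uIcc_subset_uIcc left_mem_uIcc (by rwa [uIcc_of_le hl.le]))
    rw [integralL_apply le_rfl hx.1.le hx.2.le, integralL_apply le_rfl hk7 (hk5.trans hx.2.le),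
      norm_sub_rev, intervalIntegral.integral_interval_sub_left (hii _ ⟨hx.1.le, hx.2.le⟩)
        (hii _ ⟨hk7, hk5.trans hx.2.le⟩)]
    refine (norm_integral_le hk7 hk5 hx.2.le w).trans ?_
    gcongr
  refine isCompactOperator_of_tendsto (F := F) (l := atTop) ?_ (Eventually.of_forall hF)
  rw [tendsto_iff_norm_sub_tendsto_zero]
  refine squeeze_zero (fun _ => norm_nonneg _) hbound ?_
  have h1 : Tendsto (fun N : ℕ => l / ((N : ℝ) + 1)) atTop (𝓝 0) :=
    tendsto_const_nhds.div_atTop (tendsto_atTop_add_const_right _ _ tendsto_natCast_atTop_atTop)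
  have h2 := (h1.sqrt).const_mul K
  rwa [Real.sqrt_zero, mul_zero] at h2

/-- The element of `L²(0, l)` represented by `x ↦ c + ∫₀ˣ w`. -/
def primitiveL (l : ℝ) (c : ℂ) (w : IntervalL2 l) : IntervalL2 l :=
  Lp.constL 2 (volume.restrict (Ioo (0 : ℝ) l)) ℂ c + volterra l w

/-- The continuous representative of `primitiveL l c w`. -/
def primitiveFun {l : ℝ} (c : ℂ) (w : IntervalL2 l) (x : ℝ) : ℂ := c + ∫ t in (0 : ℝ)..x, w t

@[simp]
theorem primitiveFun_zero (c : ℂ) (w : IntervalL2 l) : primitiveFun c w 0 = c := by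
  simp [primitiveFun]

theorem primitiveL_coeFn (c : ℂ) (w : IntervalL2 l) :
    ∀ᵐ x ∂volume.restrict (Ioo (0 : ℝ) l), primitiveL l c w x = primitiveFun c w x := by
  have h2 : ∀ᵐ x ∂volume.restrict (Ioo (0 : ℝ) l), x ∈ Ioo 0 l :=
    ae_restrict_mem measurableSet_Ioo
  filter_upwards [volterra_coeFn w, Lp.coeFn_const 2 (volume.restrict (Ioo (0 : ℝ) l)) c,
    Lp.coeFn_add (Lp.constL 2 (volume.restrict (Ioo (0 : ℝ) l)) ℂ c) (volterra l w), h2]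
    with x h1 h3 h4 hx
  rw [primitiveL, h4, Pi.add_apply, h1, integralL_apply le_rfl hx.1.le hx.2.le]
  change Lp.const 2 (volume.restrict (Ioo (0 : ℝ) l)) c x + _ = _
  rw [h3]
  rfl

theorem isPrimitiveOn_primitiveFun (hl : 0 ≤ l) (c : ℂ) (w : IntervalL2 l) :
    IsPrimitiveOn l (primitiveFun c w) w :=
  ⟨intervalIntegrable_coeFn hl w, fun x _ => by rw [primitiveFun_zero]; rfl⟩

theorem hasBoundaryValues_primitiveL (hl : 0 ≤ l) (c : ℂ) (w : IntervalL2 l) :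
    HasBoundaryValues (primitiveL l c w) c (primitiveFun c w l) :=
  ⟨primitiveFun c w, (isPrimitiveOn_primitiveFun hl c w).continuousOn hl, primitiveL_coeFn c w,
    primitiveFun_zero c w, rfl⟩

theorem HasBoundaryValues.unique (hl : 0 < l) {u : IntervalL2 l} {a b a' b' : ℂ}
    (h : HasBoundaryValues u a b) (h' : HasBoundaryValues u a' b') : a = a' ∧ b = b' := by
  obtain ⟨F, hF, hu, rfl, rfl⟩ := h
  obtain ⟨F', hF', hu', rfl, rfl⟩ := h'
  have h1 : F =ᵐ[volume.restrict (Icc 0 l)] F' := by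
    rw [← Measure.restrict_congr_set Ioo_ae_eq_Icc]
    filter_upwards [hu, hu'] with x hx hx'
    rw [← hx, ← hx']
  have h2 := Measure.eqOn_Icc_of_ae_eq volume hl.ne h1 hF hF'
  exact ⟨h2 (left_mem_Icc.mpr hl.le), h2 (right_mem_Icc.mpr hl.le)⟩

end IntervalSpace

/-! ### Weak derivatives, traces and the energy -/

section WeakDerivative

variable {l : ℝ}

theorem isWeakDeriv_primitiveL (hl : 0 ≤ l) (c : ℂ) (w : IntervalL2 l) :
    IsWeakDeriv (primitiveL l c w) w := by
  intro φ hφ hc hs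
  have h0 : ∀ x, x ∉ Ioo 0 l → φ x = 0 := fun x hx =>
    image_eq_zero_of_notMem_tsupport fun hx' => hx (hs hx')
  have h1 := (isPrimitiveOn_of_contDiff (l := l) hφ).integral_mul_add_mul hl
    (isPrimitiveOn_primitiveFun hl c w)
  rw [h0 l (by simp), h0 0 (by simp), Complex.ofReal_zero, zero_mul, zero_mul, sub_zero] at h1
  have h2 : ∫ x in Ioo 0 l, deriv φ x • primitiveL l c w x
      = ∫ x in Ioo 0 l, ((deriv φ x : ℝ) : ℂ) * primitiveFun c w x := by
    apply integral_congr_ae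
    filter_upwards [primitiveL_coeFn c w] with x hx
    rw [hx, Complex.real_smul]
  have h3 : ∀ x, φ x • w x = (φ x : ℂ) * w x := fun x => Complex.real_smul
  simp only [h3]
  have hd : Continuous (deriv φ) := hφ.continuous_deriv (by simp)
  have hi1 := integrable_testFun_smul (primitiveL l c w) hd hc.deriv
  have hi2 := integrable_testFun_smul w hφ.continuous hc
  simp only [h3] at hi2
  have hi1' : IntegrableOn (fun x => ((deriv φ x : ℝ) : ℂ) * primitiveFun c w x) (Ioo 0 l) := by
    refine hi1.congr ?_
    filter_upwards [primitiveL_coeFn c w] with x hx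
    rw [hx, Complex.real_smul]
  rw [integral_add hi1' hi2] at h1
  rw [h2]
  exact eq_neg_of_add_eq_zero_left h1

/-- The primitive of a test function with vanishing integral is a test function. -/
theorem exists_testFun_deriv_eq {η : ℝ → ℝ} (hη : ContDiff ℝ ∞ η) (hc : HasCompactSupport η)
    (hs : tsupport η ⊆ Ioo 0 l) (hint : ∫ x in (0 : ℝ)..l, η x = 0) :
    ∃ φ : ℝ → ℝ, ContDiff ℝ ∞ φ ∧ HasCompactSupport φ ∧ tsupport φ ⊆ Ioo 0 l ∧ deriv φ = η := by
  have hd : ∀ x, HasDerivAt (fun x => ∫ t in (0 : ℝ)..x, η t) (η x) x := fun x =>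
    hη.continuous.integral_hasStrictDerivAt 0 x |>.hasDerivAt
  have hderiv : deriv (fun x => ∫ t in (0 : ℝ)..x, η t) = η := funext fun x => (hd x).deriv
  by_cases hne : (tsupport η).Nonempty
  swap
  · rw [not_nonempty_iff_eq_empty, tsupport_eq_empty_iff] at hne
    subst hne
    refine ⟨0, contDiff_const, HasCompactSupport.zero, by simp, ?_⟩
    ext x
    simp
  obtain ⟨a, ha, hmin⟩ := hc.isCompact.exists_isMinOn hne continuousOn_id
  obtain ⟨b, hb, hmax⟩ := hc.isCompact.exists_isMaxOn hne continuousOn_id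
  have hzero : ∀ x, x ∉ Icc a b → η x = 0 := fun x hx =>
    image_eq_zero_of_notMem_tsupport fun h => hx ⟨hmin h, hmax h⟩
  have hout : ∀ x, x ∉ Icc a b → ∫ t in (0 : ℝ)..x, η t = 0 := by
    intro x hx
    rcases lt_or_ge x a with h | h
    · rw [intervalIntegral.integral_congr (g := fun _ => 0), intervalIntegral.integral_zero]
      intro t ht
      refine hzero t fun ht' => ?_
      have h1 : t ≤ max 0 x := ht.2
      exact absurd (ht'.1.trans h1) (not_le.mpr (max_lt (hs ha).1 h))
    · have hxb : b < x := not_le.mp fun h' => hx ⟨h, h'⟩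
      have h1 := intervalIntegral.integral_add_adjacent_intervals
        (hη.continuous.intervalIntegrable (μ := volume) 0 x)
        (hη.continuous.intervalIntegrable (μ := volume) x l)
      rw [hint] at h1
      have h2 : ∫ t in x..l, η t = 0 := by
        rw [intervalIntegral.integral_congr (g := fun _ => 0), intervalIntegral.integral_zero]
        intro t ht
        refine hzero t fun ht' => ?_
        have h1 : min x l ≤ t := ht.1
        exact absurd (h1.trans ht'.2) (not_le.mpr (lt_min hxb (hs hb).2))
      rwa [h2, add_zero] at h1
  have hsupp : tsupport (fun x => ∫ t in (0 : ℝ)..x, η t) ⊆ Icc a b :=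
    closure_minimal (fun x hx => by_contra fun h => hx (hout x h)) isClosed_Icc
  refine ⟨fun x => ∫ t in (0 : ℝ)..x, η t, ?_, ?_, ?_, hderiv⟩
  · rw [contDiff_infty_iff_deriv]
    exact ⟨fun x => (hd x).differentiableAt, by rwa [hderiv]⟩
  · exact HasCompactSupport.of_support_subset_isCompact isCompact_Icc
      ((subset_tsupport _).trans hsupp)
  · exact hsupp.trans (Icc_subset_Ioo (hs ha).1 (hs hb).2)

/-- The du Bois-Reymond lemma: a function with vanishing weak derivative is constant. -/
theorem exists_eq_const_of_isWeakDeriv_zero (hl : 0 < l) {u : IntervalL2 l}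
    (h : IsWeakDeriv u 0) :
    ∃ c, u = Lp.constL 2 (volume.restrict (Ioo (0 : ℝ) l)) ℂ c := by
  let ψ₀ : ContDiffBump (l / 2) := ⟨l / 8, l / 4, by positivity, by linarith⟩
  have hψs : tsupport (ψ₀.normed volume) ⊆ Ioo 0 l := by
    rw [ψ₀.tsupport_normed_eq, Real.closedBall_eq_Icc]
    exact Icc_subset_Ioo (by simp only [ψ₀]; linarith) (by simp only [ψ₀]; linarith)
  set ψ := ψ₀.normed volume with hψ
  have hψd : ContDiff ℝ ∞ ψ := ψ₀.contDiff_normed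
  have hψc : HasCompactSupport ψ := ψ₀.hasCompactSupport_normed
  have hset : ∀ {g : ℝ → ℝ}, tsupport g ⊆ Ioo 0 l → ∫ x in (0 : ℝ)..l, g x = ∫ x, g x := by
    intro g hg
    rw [intervalIntegral.integral_of_le hl.le]
    apply setIntegral_eq_integral_of_forall_compl_eq_zero
    intro x hx
    exact image_eq_zero_of_notMem_tsupport fun hx' => hx (Ioo_subset_Ioc_self (hg hx'))
  have hψi : ∫ x in (0 : ℝ)..l, ψ x = 1 := by rw [hset hψs, hψ, ψ₀.integral_normed]
  set c := ∫ x in Ioo 0 l, ψ x • u x with hc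
  refine ⟨c, ?_⟩
  have hu : Integrable (fun x => u x) (volume.restrict (Ioo (0 : ℝ) l)) :=
    (Lp.memLp u).integrable (by norm_num)
  have hcc : Integrable (fun _ : ℝ => c) (volume.restrict (Ioo (0 : ℝ) l)) := integrable_const _
  have key := isOpen_Ioo.ae_eq_zero_of_integral_contDiff_smul_eq_zero (μ := volume)
    (U := Ioo (0 : ℝ) l) (f := fun x => u x - c)
    (IntegrableOn.locallyIntegrableOn (hu.sub hcc)) (by
      intro g hg hgc hgs
      have e : ∫ x, g x • (u x - c) = ∫ x in Ioo 0 l, g x • (u x - c) := by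
        symm
        apply setIntegral_eq_integral_of_forall_compl_eq_zero
        intro x hx
        rw [image_eq_zero_of_notMem_tsupport (fun hx' => hx (hgs hx')), zero_smul]
      rw [e]
      simp only [smul_sub]
      have hi1 := integrable_testFun_smul u hg.continuous hgc
      have hi2 : IntegrableOn (fun x => g x • c) (Ioo 0 l) :=
        ((hg.continuous.integrable_of_hasCompactSupport hgc).smul_const c).integrableOn
      rw [integral_sub hi1 hi2]
      set m := ∫ x in (0 : ℝ)..l, g x with hm
      have hi3 : Continuous fun x => m * ψ x := continuous_const.mul hψd.continuous
      have hi4 : IntegrableOn (fun x => m • ψ x • u x) (Ioo 0 l) :=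
        (integrable_testFun_smul u hψd.continuous hψc).smul m
      -- `g - m ψ` has vanishing integral, hence is the derivative of a test function
      have hηs : tsupport (fun x => g x - m * ψ x) ⊆ Ioo 0 l := by
        refine (tsupport_sub _ _).trans (union_subset hgs ?_)
        exact (closure_mono (Function.support_mul_subset_right _ _)).trans hψs
      obtain ⟨φ, h1, h2, h3, h4⟩ := exists_testFun_deriv_eq (l := l)
        (η := fun x => g x - m * ψ x)
        (hg.sub (contDiff_const.mul hψd)) (hgc.sub hψc.mul_left) hηs (by
          rw [intervalIntegral.integral_sub (hg.continuous.intervalIntegrable _ _)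
            (hi3.intervalIntegrable _ _),
            intervalIntegral.integral_const_mul, hψi, mul_one, sub_self])
      have h5 := h φ h1 h2 h3
      have h6 : ∫ x in Ioo 0 l, φ x • (0 : IntervalL2 l) x = 0 := by
        rw [← integral_zero ℝ ℂ (μ := volume.restrict (Ioo (0 : ℝ) l))]
        apply integral_congr_ae
        filter_upwards [Lp.coeFn_zero ℂ 2 (volume.restrict (Ioo (0 : ℝ) l))] with x hx
        rw [hx, Pi.zero_apply, smul_zero]
      rw [h6, neg_zero, h4] at h5
      simp only [sub_smul, mul_smul] at h5
      rw [integral_sub hi1 hi4, integral_smul, ← hc] at h5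
      rw [integral_smul_const, ← integral_Ioc_eq_integral_Ioo (f := g),
        ← intervalIntegral.integral_of_le hl.le, ← hm]
      exact h5)
  apply Lp.ext
  have h1 := Lp.coeFn_const 2 (volume.restrict (Ioo (0 : ℝ) l)) c
  have h2 : ∀ᵐ x ∂volume.restrict (Ioo (0 : ℝ) l), u x - c = 0 := by
    rw [ae_restrict_iff' measurableSet_Ioo]
    exact key
  filter_upwards [h1, h2] with x hx1 hx2
  exact (sub_eq_zero.mp hx2).trans hx1.symm

/-- A function with a weak derivative in `L²` is the primitive of its weak derivative. -/
theorem IsWeakDeriv.exists_eq_primitiveL (hl : 0 < l) {u w : IntervalL2 l}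
    (h : IsWeakDeriv u w) : ∃ c, u = primitiveL l c w := by
  have h1 := h.add ((isWeakDeriv_primitiveL hl.le 0 w).smul (-1))
  rw [neg_one_smul, neg_one_smul, add_neg_cancel] at h1
  obtain ⟨c, hc⟩ := exists_eq_const_of_isWeakDeriv_zero hl h1
  refine ⟨c, ?_⟩
  rw [primitiveL, map_zero, zero_add] at hc
  rw [primitiveL, ← hc, neg_add_cancel_right]

end WeakDerivative

section Estimates

variable {l : ℝ}

theorem norm_sq_eq_integral (u : IntervalL2 l) : ‖u‖ ^ 2 = ∫ x in Ioo 0 l, ‖u x‖ ^ 2 := by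
  have h1 : ⟪u, u⟫_ℂ = ((∫ x in Ioo 0 l, ‖u x‖ ^ 2 : ℝ) : ℂ) := by
    rw [L2.inner_def, ← integral_complex_ofReal]
    congr 1
    ext x
    rw [inner_self_eq_norm_sq_to_K]
    norm_cast
  exact Complex.ofReal_injective (Eq.trans (by rw [inner_self_eq_norm_sq_to_K]; norm_cast) h1)

theorem integrable_norm_sq (u : IntervalL2 l) :
    Integrable (fun x => ‖u x‖ ^ 2) (volume.restrict (Ioo (0 : ℝ) l)) :=
  (Lp.memLp u).integrable_norm_pow (by norm_num)

theorem inner_add_inner_primitiveL (hl : 0 ≤ l) (c c' : ℂ) (w w' : IntervalL2 l) :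
    ⟪w, primitiveL l c' w'⟫_ℂ + ⟪primitiveL l c w, w'⟫_ℂ
      = conj (primitiveFun c w l) * primitiveFun c' w' l - conj c * c' := by
  have h1 := (isPrimitiveOn_primitiveFun hl c w).conj.integral_mul_add_mul hl
    (isPrimitiveOn_primitiveFun hl c' w')
  rw [primitiveFun_zero, primitiveFun_zero] at h1
  rw [← h1, L2.inner_def, L2.inner_def, ← integral_add (L2.integrable_inner _ _)
    (L2.integrable_inner _ _)]
  apply integral_congr_ae
  filter_upwards [primitiveL_coeFn c w, primitiveL_coeFn c' w'] with x hx hx'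
  rw [hx, hx', RCLike.inner_apply, RCLike.inner_apply]
  ring

theorem two_mul_le_mul_sq_add_sq_div {a b t : ℝ} (ht : 0 < t) :
    2 * (a * b) ≤ t * a ^ 2 + b ^ 2 / t := by
  have h1 : 0 ≤ (t * a - b) ^ 2 / t := by positivity
  have h2 : (t * a - b) ^ 2 / t = t * a ^ 2 + b ^ 2 / t - 2 * (a * b) := by field_simp; ring
  linarith

theorem integral_norm_le_of_ae_le {k : ℝ → ℂ} {u v : IntervalL2 l} {t : ℝ} (ht : 0 < t)
    (hk : ∀ᵐ x ∂volume.restrict (Ioo (0 : ℝ) l), ‖k x‖ ≤ 2 * (‖u x‖ * ‖v x‖)) :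
    ∫ x in Ioo 0 l, ‖k x‖ ≤ t * ‖u‖ ^ 2 + ‖v‖ ^ 2 / t := by
  rw [norm_sq_eq_integral, norm_sq_eq_integral, ← integral_const_mul, ← integral_div,
    ← integral_add ((integrable_norm_sq u).const_mul t) ((integrable_norm_sq v).div_const t)]
  refine integral_mono_of_nonneg (Eventually.of_forall fun _ => norm_nonneg _)
    (((integrable_norm_sq u).const_mul t).add ((integrable_norm_sq v).div_const t)) ?_
  filter_upwards [hk] with x hx
  exact hx.trans (two_mul_le_mul_sq_add_sq_div ht)

/-- The trace inequality on an interval, with a free parameter `t` to make the derivative small. -/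
theorem mul_norm_primitiveFun_sq_le (c : ℂ) (w : IntervalL2 l) {y : ℝ} (hy : y ∈ Icc 0 l)
    {t : ℝ} (ht : 0 < t) :
    l * ‖primitiveFun c w y‖ ^ 2 ≤
      ‖primitiveL l c w‖ ^ 2 + l * (t * ‖w‖ ^ 2 + ‖primitiveL l c w‖ ^ 2 / t) := by
  have hl : 0 ≤ l := hy.1.trans hy.2
  have hp := isPrimitiveOn_primitiveFun hl c w
  have h1 := (hp.mul hl hp.conj).norm_integral_sub_le hy
  have h2 : ∫ x in Ioo 0 l, primitiveFun c w x * conj (primitiveFun c w x)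
      = ((‖primitiveL l c w‖ ^ 2 : ℝ) : ℂ) := by
    rw [norm_sq_eq_integral, ← integral_complex_ofReal]
    apply integral_congr_ae
    filter_upwards [primitiveL_coeFn c w] with x hx
    rw [hx, Complex.mul_conj']
    push_cast
    rfl
  rw [h2, Complex.mul_conj', ← Complex.ofReal_pow, ← Complex.ofReal_mul, ← Complex.ofReal_sub,
    Complex.norm_real, Real.norm_eq_abs] at h1
  have h3 := integral_norm_le_of_ae_le (u := w) (v := primitiveL l c w) ht
    (k := fun x => w x * conj (primitiveFun c w x) + primitiveFun c w x * conj (w x)) (by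
      filter_upwards [primitiveL_coeFn c w] with x hx
      refine (norm_add_le _ _).trans (le_of_eq ?_)
      rw [norm_mul, norm_mul, RCLike.norm_conj, RCLike.norm_conj, hx]
      ring)
  have h4 := neg_abs_le (‖primitiveL l c w‖ ^ 2 - l * ‖primitiveFun c w y‖ ^ 2)
  have h5 := mul_le_mul_of_nonneg_left h3 hl
  linarith

/-- For a solution of `f'' = -lam f + g`, the energy `|f'|² + lam |f|²` changes only by the action
of `g`. Hence its value at any point is controlled by its mean value. -/
theorem abs_energy_sub_le {lam : ℝ} {f p r g : IntervalL2 l} {c d : ℂ}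
    (hf : f = primitiveL l c p) (hp : p = primitiveL l d r) (hr : r = -((lam : ℂ) • f) + g)
    {y : ℝ} (hy : y ∈ Icc 0 l) {t : ℝ} (ht : 0 < t) :
    |‖p‖ ^ 2 + lam * ‖f‖ ^ 2 - l * (‖primitiveFun d r y‖ ^ 2 + lam * ‖primitiveFun c p y‖ ^ 2)|
      ≤ l * (t * ‖g‖ ^ 2 + ‖p‖ ^ 2 / t) := by
  have hl : 0 ≤ l := hy.1.trans hy.2
  have hF := isPrimitiveOn_primitiveFun hl c p
  have hP := isPrimitiveOn_primitiveFun hl d r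
  have hfx : ∀ᵐ x ∂volume.restrict (Ioo (0 : ℝ) l), f x = primitiveFun c p x := by
    filter_upwards [primitiveL_coeFn c p] with x hx
    rw [← hx, ← hf]
  have hpx : ∀ᵐ x ∂volume.restrict (Ioo (0 : ℝ) l), p x = primitiveFun d r x := by
    filter_upwards [primitiveL_coeFn d r] with x hx
    rw [← hx, ← hp]
  have hrx : ∀ᵐ x ∂volume.restrict (Ioo (0 : ℝ) l), r x = -(lam * f x) + g x := by
    filter_upwards [Lp.coeFn_add (-((lam : ℂ) • f)) g, Lp.coeFn_neg ((lam : ℂ) • f),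
      Lp.coeFn_smul (lam : ℂ) f] with x h1 h2 h3
    rw [hr, h1, Pi.add_apply, h2, Pi.neg_apply, h3, Pi.smul_apply, smul_eq_mul]
  have hE := (hP.mul hl hP.conj).add hl ((hF.mul hl hF.conj).const_mul (lam : ℂ))
  have hE' := hE.congr_deriv hl (w' := fun x => g x * conj (p x) + p x * conj (g x)) (by
    filter_upwards [hfx, hpx, hrx] with x h1 h2 h3
    rw [h3, ← h1, ← h2, map_add, map_neg, map_mul, Complex.conj_ofReal]
    ring)
  have h1 := hE'.norm_integral_sub_le hy
  have h2 : ∫ x in Ioo 0 l, (primitiveFun d r x * conj (primitiveFun d r x)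
      + lam * (primitiveFun c p x * conj (primitiveFun c p x)))
      = ((‖p‖ ^ 2 + lam * ‖f‖ ^ 2 : ℝ) : ℂ) := by
    rw [norm_sq_eq_integral, norm_sq_eq_integral, ← integral_const_mul,
      ← integral_add (integrable_norm_sq p) ((integrable_norm_sq f).const_mul _),
      ← integral_complex_ofReal]
    apply integral_congr_ae
    filter_upwards [hfx, hpx] with x h1 h2
    rw [← h1, ← h2, Complex.mul_conj', Complex.mul_conj']
    push_cast
    rfl
  rw [h2, Complex.mul_conj', Complex.mul_conj', ← Complex.ofReal_pow, ← Complex.ofReal_pow,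
    ← Complex.ofReal_mul, ← Complex.ofReal_add, ← Complex.ofReal_mul, ← Complex.ofReal_sub,
    Complex.norm_real, Real.norm_eq_abs] at h1
  refine h1.trans (mul_le_mul_of_nonneg_left (integral_norm_le_of_ae_le ht ?_) hl)
  refine Eventually.of_forall fun x => (norm_add_le _ _).trans (le_of_eq ?_)
  rw [norm_mul, norm_mul, RCLike.norm_conj, RCLike.norm_conj]
  ring

end Estimates

/-! ### The quadratic form of a metric graph -/

section PiOperators

variable {ι : Type*} {β : ι → Type*} [∀ i, NormedAddCommGroup (β i)]
  [∀ i, InnerProductSpace ℂ (β i)] {X : Type*} [NormedAddCommGroup X] [NormedSpace ℂ X]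

/-- The continuous linear map into a finite Hilbert sum with prescribed components. -/
def piLpMap (T : ∀ i, X →L[ℂ] β i) : X →L[ℂ] PiLp 2 β :=
  ((PiLp.continuousLinearEquiv 2 ℂ β).symm : (∀ i, β i) →L[ℂ] PiLp 2 β) ∘L
    ContinuousLinearMap.pi T

theorem isCompactOperator_piLpMap [Finite ι] {T : ∀ i, X →L[ℂ] β i}
    (hT : ∀ i, IsCompactOperator (T i)) :
    IsCompactOperator (piLpMap T) := by
  have h : IsCompactOperator (ContinuousLinearMap.pi T) := by
    choose K hK hT using hT
    refine ⟨Set.pi univ K, isCompact_univ_pi hK, ?_⟩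
    filter_upwards [eventually_all.mpr hT] with x hx
    exact fun i _ => hx i
  exact h.clm_comp ((PiLp.continuousLinearEquiv 2 ℂ β).symm : (∀ i, β i) →L[ℂ] PiLp 2 β)

end PiOperators

namespace MetricGraph

variable {Vtx E : Type*} {Γ : MetricGraph Vtx E}

/-- In a connected graph with an edge, every vertex is an end of an edge. -/
theorem Connected.exists_edge [Nonempty E] (hΓ : Γ.Connected) (v : Vtx) :
    ∃ e, Γ.src e = v ∨ Γ.tgt e = v := by
  obtain ⟨e₀⟩ := ‹Nonempty E›
  by_cases h : Γ.src e₀ = v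
  · exact ⟨e₀, Or.inl h⟩
  obtain ⟨p⟩ := hΓ.preconnected v (Γ.src e₀)
  cases p with
  | nil => exact absurd rfl h
  | cons hadj _ =>
    rw [SimpleGraph.fromRel_adj] at hadj
    rcases hadj.2 with ⟨e, h1, -⟩ | ⟨e, -, h1⟩
    · exact ⟨e, Or.inl h1⟩
    · exact ⟨e, Or.inr h1⟩

/-- Multiplication by the potential on one edge, as a bounded operator. -/
def Potential.mulL (V : Γ.Potential) (e : E) : IntervalL2 (Γ.len e) →L[ℂ] IntervalL2 (Γ.len e) :=
  LinearMap.mkContinuous (V.mul e) (V.bounded e).choose (fun u => by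
    refine Lp.norm_le_mul_norm_of_ae_le_mul ?_
    have h2 : ∀ᵐ x ∂volume.restrict (Ioo (0 : ℝ) (Γ.len e)), x ∈ Ioo 0 (Γ.len e) :=
      ae_restrict_mem measurableSet_Ioo
    filter_upwards [(V.memLp_mul e u).coeFn_toLp, h2] with x hx hxm
    change ‖(V.memLp_mul e u).toLp _ x‖ ≤ _
    rw [hx, norm_mul, Complex.norm_real, Real.norm_eq_abs]
    exact mul_le_mul_of_nonneg_right ((V.bounded e).choose_spec x hxm) (norm_nonneg _))

theorem Potential.inner_mul (V : Γ.Potential) (e : E) (u v : IntervalL2 (Γ.len e)) :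
    ⟪V.mul e u, v⟫_ℂ = ⟪u, V.mul e v⟫_ℂ := by
  rw [L2.inner_def, L2.inner_def]
  apply integral_congr_ae
  filter_upwards [(V.memLp_mul e u).coeFn_toLp, (V.memLp_mul e v).coeFn_toLp] with x hx hx'
  change ⟪(V.memLp_mul e u).toLp _ x, _⟫_ℂ = ⟪_, (V.memLp_mul e v).toLp _ x⟫_ℂ
  rw [hx, hx', RCLike.inner_apply, RCLike.inner_apply, map_mul, Complex.conj_ofReal]
  ring

variable [Fintype E]

/-- Multiplication by the potential on `L²(Γ)`. -/
def Potential.op (V : Γ.Potential) : Γ.L2 →L[ℂ] Γ.L2 :=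
  piLpMap fun e => V.mulL e ∘L PiLp.proj 2 (𝕜 := ℂ) (fun e => IntervalL2 (Γ.len e)) e

theorem Potential.inner_op (V : Γ.Potential) (f g : Γ.L2) :
    ⟪V.op f, g⟫_ℂ = ⟪f, V.op g⟫_ℂ := by
  rw [PiLp.inner_apply, PiLp.inner_apply]
  exact Finset.sum_congr rfl fun e _ => V.inner_mul e _ _

theorem norm_apply_sq_le (f : Γ.L2) (e : E) : ‖f e‖ ^ 2 ≤ ‖f‖ ^ 2 := by
  rw [PiLp.norm_sq_eq_of_L2]
  exact Finset.single_le_sum (f := fun e => ‖f e‖ ^ 2) (fun _ _ => sq_nonneg _) (Finset.mem_univ e)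

/-- The condition that a function with derivative `y.snd` on the edge `e`, starting with the vertex
value of `y.fst` at the initial vertex, arrives at the vertex value at the terminal vertex. -/
def continuityDefect (Γ : MetricGraph Vtx E) (e : E) :
    WithLp 2 (EuclideanSpace ℂ Vtx × Γ.L2) →L[ℂ] ℂ :=
  PiLp.proj 2 (𝕜 := ℂ) (fun _ : Vtx => ℂ) (Γ.tgt e) ∘L WithLp.fstL 2 ℂ (EuclideanSpace ℂ Vtx) Γ.L2
  - PiLp.proj 2 (𝕜 := ℂ) (fun _ : Vtx => ℂ) (Γ.src e) ∘L WithLp.fstL 2 ℂ (EuclideanSpace ℂ Vtx) Γ.L2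
  - integralL (Γ.len e) 0 (Γ.len e) ∘L PiLp.proj 2 (𝕜 := ℂ) (fun e => IntervalL2 (Γ.len e)) e ∘L
    WithLp.sndL 2 ℂ (EuclideanSpace ℂ Vtx) Γ.L2

/-- The form domain `H¹(Γ)` of functions that are continuous across the vertices, as a subspace of a
Hilbert space: a function is recorded by its values at the vertices and its derivative. -/
def formSubmodule (Γ : MetricGraph Vtx E) : Submodule ℂ (WithLp 2 (EuclideanSpace ℂ Vtx × Γ.L2)) :=
  ⨅ e, LinearMap.ker (Γ.continuityDefect e : WithLp 2 (EuclideanSpace ℂ Vtx × Γ.L2) →ₗ[ℂ] ℂ)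

theorem mem_formSubmodule {a : EuclideanSpace ℂ Vtx} {g : Γ.L2} :
    WithLp.toLp 2 (a, g) ∈ Γ.formSubmodule ↔
      ∀ e, a (Γ.tgt e) = primitiveFun (a (Γ.src e)) (g e) (Γ.len e) := by
  rw [formSubmodule, Submodule.mem_iInf]
  refine forall_congr' fun e => ?_
  rw [LinearMap.mem_ker, primitiveFun, ← integralL_apply le_rfl (Γ.len_pos e).le le_rfl]
  change a (Γ.tgt e) - a (Γ.src e) - integralL (Γ.len e) 0 (Γ.len e) (g e) = 0 ↔ _
  rw [sub_sub, sub_eq_zero]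

variable [Fintype Vtx]

/-- Multiplication of the vertex values by the coupling constants. -/
def vertexOp (σ : Vtx → ℝ) : EuclideanSpace ℂ Vtx →L[ℂ] EuclideanSpace ℂ Vtx :=
  piLpMap fun v => (σ v : ℂ) • PiLp.proj 2 (𝕜 := ℂ) (fun _ : Vtx => ℂ) v

theorem inner_vertexOp (σ : Vtx → ℝ) (a b : EuclideanSpace ℂ Vtx) :
    ⟪vertexOp σ a, b⟫_ℂ = ∑ v, σ v * conj (a v) * b v := by
  rw [PiLp.inner_apply]
  refine Finset.sum_congr rfl fun v _ => ?_
  change ⟪(σ v : ℂ) * a v, b v⟫_ℂ = _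
  rw [RCLike.inner_apply, map_mul, Complex.conj_ofReal]
  ring

/-- The form domain `H¹(Γ)`, as a Hilbert space in its own right. -/
def FormDomain (Γ : MetricGraph Vtx E) : Type _ := Γ.formSubmodule

instance (Γ : MetricGraph Vtx E) : NormedAddCommGroup Γ.FormDomain :=
  inferInstanceAs (NormedAddCommGroup Γ.formSubmodule)

instance (Γ : MetricGraph Vtx E) : InnerProductSpace ℂ Γ.FormDomain :=
  inferInstanceAs (InnerProductSpace ℂ Γ.formSubmodule)

instance (Γ : MetricGraph Vtx E) : CompleteSpace Γ.FormDomain := by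
  have h : IsClosed (Γ.formSubmodule : Set (WithLp 2 (EuclideanSpace ℂ Vtx × Γ.L2))) := by
    rw [formSubmodule, Submodule.coe_iInf]
    exact isClosed_iInter fun e => (Γ.continuityDefect e).isClosed_ker
  exact h.completeSpace_coe

theorem norm_sq_eq_add (y : Γ.formSubmodule) :
    ‖y‖ ^ 2 = ‖(y : WithLp 2 (EuclideanSpace ℂ Vtx × Γ.L2)).fst‖ ^ 2
      + ‖(y : WithLp 2 (EuclideanSpace ℂ Vtx × Γ.L2)).snd‖ ^ 2 :=
  WithLp.prod_norm_sq_eq_of_L2 (y : WithLp 2 (EuclideanSpace ℂ Vtx × Γ.L2))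

/-- The values at the vertices of a function in the form domain. -/
def vertexValue (Γ : MetricGraph Vtx E) : Γ.FormDomain →L[ℂ] EuclideanSpace ℂ Vtx :=
  LinearMap.mkContinuous
    { toFun := fun y : Γ.formSubmodule => (y : WithLp 2 (EuclideanSpace ℂ Vtx × Γ.L2)).fst
      map_add' := fun _ _ => rfl
      map_smul' := fun _ _ => rfl } 1 (fun y => by
    rw [one_mul]
    refine abs_le_of_sq_le_sq' ?_ (norm_nonneg _) |>.2
    exact le_of_le_of_eq (le_add_of_nonneg_right (sq_nonneg _)) (norm_sq_eq_add y).symm)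

/-- The derivative of a function in the form domain. -/
def derivative (Γ : MetricGraph Vtx E) : Γ.FormDomain →L[ℂ] Γ.L2 :=
  LinearMap.mkContinuous
    { toFun := fun y : Γ.formSubmodule => (y : WithLp 2 (EuclideanSpace ℂ Vtx × Γ.L2)).snd
      map_add' := fun _ _ => rfl
      map_smul' := fun _ _ => rfl } 1 (fun y => by
    rw [one_mul]
    refine abs_le_of_sq_le_sq' ?_ (norm_nonneg _) |>.2
    exact le_of_le_of_eq (le_add_of_nonneg_left (sq_nonneg _)) (norm_sq_eq_add y).symm)

/-- The embedding of the form domain into `L²(Γ)`. -/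
def embed (Γ : MetricGraph Vtx E) : Γ.FormDomain →L[ℂ] Γ.L2 :=
  piLpMap fun e =>
    Lp.constL 2 (volume.restrict (Ioo (0 : ℝ) (Γ.len e))) ℂ ∘L
      PiLp.proj 2 (𝕜 := ℂ) (fun _ : Vtx => ℂ) (Γ.src e) ∘L Γ.vertexValue
    + volterra (Γ.len e) ∘L
      PiLp.proj 2 (𝕜 := ℂ) (fun e => IntervalL2 (Γ.len e)) e ∘L Γ.derivative

theorem embed_apply (y : Γ.FormDomain) (e : E) :
    Γ.embed y e = primitiveL (Γ.len e) (Γ.vertexValue y (Γ.src e)) (Γ.derivative y e) := rfl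

theorem exists_formDomain {a : EuclideanSpace ℂ Vtx} {g : Γ.L2}
    (h : ∀ e, a (Γ.tgt e) = primitiveFun (a (Γ.src e)) (g e) (Γ.len e)) :
    ∃ y : Γ.FormDomain, Γ.vertexValue y = a ∧ Γ.derivative y = g :=
  ⟨⟨WithLp.toLp 2 (a, g), mem_formSubmodule.mpr h⟩, rfl, rfl⟩

theorem vertexValue_tgt (y : Γ.FormDomain) (e : E) : Γ.vertexValue y (Γ.tgt e) =
    primitiveFun (Γ.vertexValue y (Γ.src e)) (Γ.derivative y e) (Γ.len e) :=
  mem_formSubmodule.mp y.2 e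

theorem norm_sq_formDomain (y : Γ.FormDomain) :
    ‖y‖ ^ 2 = ‖Γ.vertexValue y‖ ^ 2 + ‖Γ.derivative y‖ ^ 2 :=
  norm_sq_eq_add y

theorem isCompactOperator_embed (Γ : MetricGraph Vtx E) : IsCompactOperator Γ.embed := by
  refine isCompactOperator_piLpMap fun e => IsCompactOperator.add ?_ ?_
  · have h : IsCompactOperator (Lp.constL 2 (volume.restrict (Ioo (0 : ℝ) (Γ.len e))) ℂ :
        ℂ →L[ℂ] IntervalL2 (Γ.len e)) := isCompactOperator_of_locallyCompactSpace_rng _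
    exact h.comp_clm _
  · exact (isCompactOperator_volterra (Γ.len_pos e)).comp_clm _

/-- The operator on the form domain which represents the quadratic form
`‖f'‖² + ⟪V f, f⟫ + ∑ σ v |f v|²`. -/
def formOp (V : Γ.Potential) (σ : Vtx → ℝ) : Γ.FormDomain →L[ℂ] Γ.FormDomain :=
  Γ.derivative.adjoint ∘L Γ.derivative + Γ.embed.adjoint ∘L V.op ∘L Γ.embed
    + Γ.vertexValue.adjoint ∘L vertexOp σ ∘L Γ.vertexValue

theorem inner_formOp (V : Γ.Potential) (σ : Vtx → ℝ) (y z : Γ.FormDomain) :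
    ⟪formOp V σ y, z⟫_ℂ = ⟪Γ.derivative y, Γ.derivative z⟫_ℂ + ⟪V.op (Γ.embed y), Γ.embed z⟫_ℂ
      + ⟪vertexOp σ (Γ.vertexValue y), Γ.vertexValue z⟫_ℂ := by
  change ⟪Γ.derivative.adjoint (Γ.derivative y) + Γ.embed.adjoint (V.op (Γ.embed y))
    + Γ.vertexValue.adjoint (vertexOp σ (Γ.vertexValue y)), z⟫_ℂ = _
  rw [inner_add_left, inner_add_left, ContinuousLinearMap.adjoint_inner_left,
    ContinuousLinearMap.adjoint_inner_left, ContinuousLinearMap.adjoint_inner_left]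

theorem isSymmetric_formOp (V : Γ.Potential) (σ : Vtx → ℝ) : (formOp V σ).IsSymmetric := by
  intro y z
  change ⟪formOp V σ y, z⟫_ℂ = ⟪y, formOp V σ z⟫_ℂ
  rw [← inner_conj_symm y, inner_formOp, inner_formOp, map_add, map_add, inner_conj_symm,
    inner_conj_symm, V.inner_op, inner_vertexOp, inner_vertexOp, map_sum]
  congr 1
  refine Finset.sum_congr rfl fun v _ => ?_
  rw [map_mul, map_mul, Complex.conj_ofReal, Complex.conj_conj]
  ring

theorem abs_re_inner_formOp_sub_le (V : Γ.Potential) (σ : Vtx → ℝ) (y : Γ.FormDomain) :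
    |(⟪formOp V σ y, y⟫_ℂ).re - ‖Γ.derivative y‖ ^ 2|
      ≤ ‖V.op‖ * ‖Γ.embed y‖ ^ 2 + ‖vertexOp σ‖ * ‖Γ.vertexValue y‖ ^ 2 := by
  have h1 : |(⟪V.op (Γ.embed y), Γ.embed y⟫_ℂ).re| ≤ ‖V.op‖ * ‖Γ.embed y‖ ^ 2 := by
    refine (Complex.abs_re_le_norm _).trans ((norm_inner_le_norm _ _).trans ?_)
    rw [pow_two, ← mul_assoc]
    exact mul_le_mul_of_nonneg_right (V.op.le_opNorm _) (norm_nonneg _)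
  have h2 : |(⟪vertexOp σ (Γ.vertexValue y), Γ.vertexValue y⟫_ℂ).re|
      ≤ ‖vertexOp σ‖ * ‖Γ.vertexValue y‖ ^ 2 := by
    refine (Complex.abs_re_le_norm _).trans ((norm_inner_le_norm _ _).trans ?_)
    rw [pow_two, ← mul_assoc]
    exact mul_le_mul_of_nonneg_right ((vertexOp σ).le_opNorm _) (norm_nonneg _)
  have h3 : (⟪Γ.derivative y, Γ.derivative y⟫_ℂ).re = ‖Γ.derivative y‖ ^ 2 := by
    rw [inner_self_eq_norm_sq_to_K]
    norm_cast
  rw [inner_formOp, Complex.add_re, Complex.add_re, h3]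
  refine (abs_add_le _ _ |>.trans' (le_of_eq ?_)).trans (add_le_add h1 h2)
  ring_nf

/-- The value at a vertex is the value at an end of an adjacent edge. -/
theorem Connected.exists_vertexValue_eq [Nonempty E] (hΓ : Γ.Connected) (v : Vtx) :
    ∃ e, ∃ x ∈ Icc 0 (Γ.len e), ∀ y : Γ.FormDomain, Γ.vertexValue y v =
      primitiveFun (Γ.vertexValue y (Γ.src e)) (Γ.derivative y e) x := by
  obtain ⟨e, rfl | rfl⟩ := hΓ.exists_edge v
  · exact ⟨e, 0, left_mem_Icc.mpr (Γ.len_pos e).le, fun y => by rw [primitiveFun_zero]⟩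
  · exact ⟨e, Γ.len e, right_mem_Icc.mpr (Γ.len_pos e).le, fun y => vertexValue_tgt y e⟩

/-- The trace inequality: the vertex values are bounded relative to the derivative with arbitrarily
small relative bound. -/
theorem Connected.exists_norm_vertexValue_sq_le [Nonempty E] (hΓ : Γ.Connected) {ε : ℝ}
    (hε : 0 < ε) : ∃ K, 0 ≤ K ∧ ∀ y : Γ.FormDomain,
      ‖Γ.vertexValue y‖ ^ 2 ≤ ε * ‖Γ.derivative y‖ ^ 2 + K * ‖Γ.embed y‖ ^ 2 := by
  choose e x hx hv using hΓ.exists_vertexValue_eq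
  set t : ℝ := ε / (Fintype.card Vtx + 1) with ht
  have ht0 : 0 < t := by positivity
  refine ⟨∑ v, (1 / Γ.len (e v) + 1 / t), Finset.sum_nonneg fun v _ => ?_, fun y => ?_⟩
  · have := Γ.len_pos (e v); positivity
  have h1 : ∀ v, ‖Γ.vertexValue y v‖ ^ 2
      ≤ t * ‖Γ.derivative y‖ ^ 2 + (1 / Γ.len (e v) + 1 / t) * ‖Γ.embed y‖ ^ 2 := by
    intro v
    have hl := Γ.len_pos (e v)
    have h2 := mul_norm_primitiveFun_sq_le (Γ.vertexValue y (Γ.src (e v)))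
      (Γ.derivative y (e v)) (hx v) ht0
    rw [← hv, ← embed_apply] at h2
    have h3 : ‖Γ.vertexValue y v‖ ^ 2 ≤ t * ‖Γ.derivative y (e v)‖ ^ 2
        + (1 / Γ.len (e v) + 1 / t) * ‖Γ.embed y (e v)‖ ^ 2 := by
      refine le_of_mul_le_mul_left (h2.trans (le_of_eq ?_)) hl
      field_simp
      ring
    have h4 := norm_apply_sq_le (Γ.derivative y) (e v)
    have h5 := norm_apply_sq_le (Γ.embed y) (e v)
    refine h3.trans ?_
    gcongr
  rw [PiLp.norm_sq_eq_of_L2]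
  refine (Finset.sum_le_sum fun v _ => h1 v).trans ?_
  rw [Finset.sum_add_distrib, Finset.sum_const, nsmul_eq_mul, Finset.card_univ,
    ← mul_assoc, ← Finset.sum_mul]
  have h6 : (Fintype.card Vtx : ℝ) * t ≤ ε := by
    rw [ht, mul_div_assoc', div_le_iff₀ (by positivity)]
    nlinarith
  gcongr

/-- The form is coercive on the form domain, up to a multiple of the norm of `L²(Γ)`. -/
theorem Connected.exists_le_re_inner_formOp [Nonempty E] (hΓ : Γ.Connected) (V : Γ.Potential)
    (σ : Vtx → ℝ) : ∃ c, 0 ≤ c ∧ ∀ y : Γ.FormDomain,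
      1 / 2 * ‖y‖ ^ 2 ≤ (⟪formOp V σ y, y⟫_ℂ).re + c * ‖Γ.embed y‖ ^ 2 := by
  set s := ‖vertexOp σ‖ with hs
  obtain ⟨K, hK0, hK⟩ := hΓ.exists_norm_vertexValue_sq_le (ε := 1 / (2 * (s + 1))) (by positivity)
  refine ⟨‖V.op‖ + (s + 1) * K, by positivity, fun y => ?_⟩
  have h1 := (abs_le.mp (abs_re_inner_formOp_sub_le V σ y)).1
  have h2 := mul_le_mul_of_nonneg_left (hK y) (show 0 ≤ s + 1 by positivity)
  have hs1 : s + 1 ≠ 0 := by positivity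
  have h3 : (s + 1) * (1 / (2 * (s + 1)) * ‖Γ.derivative y‖ ^ 2 + K * ‖Γ.embed y‖ ^ 2)
      = 1 / 2 * ‖Γ.derivative y‖ ^ 2 + (s + 1) * K * ‖Γ.embed y‖ ^ 2 := by
    field_simp
  rw [h3] at h2
  rw [norm_sq_formDomain]
  nlinarith [sq_nonneg ‖Γ.vertexValue y‖]

end MetricGraph

/-! ### Test functions on a metric graph -/

section TestFunctions

variable {l : ℝ}

/-- A test function as an element of `L²(0, l)`. -/
def testFunL (l : ℝ) {φ : ℝ → ℝ} (hφ : Continuous φ) (hc : HasCompactSupport φ) : IntervalL2 l :=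
  MemLp.toLp (fun x => (φ x : ℂ)) (by
    have h1 : HasCompactSupport fun x => (φ x : ℂ) := hc.comp_left Complex.ofReal_zero
    exact ((Complex.continuous_ofReal.comp hφ).memLp_of_hasCompactSupport h1).restrict _)

theorem testFunL_coeFn {φ : ℝ → ℝ} (hφ : Continuous φ) (hc : HasCompactSupport φ) :
    ∀ᵐ x ∂volume.restrict (Ioo (0 : ℝ) l), testFunL l hφ hc x = φ x :=
  MemLp.coeFn_toLp _

theorem inner_testFunL {φ : ℝ → ℝ} (hφ : Continuous φ) (hc : HasCompactSupport φ)
    (u : IntervalL2 l) : ⟪testFunL l hφ hc, u⟫_ℂ = ∫ x in Ioo 0 l, φ x • u x := by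
  rw [L2.inner_def]
  apply integral_congr_ae
  filter_upwards [testFunL_coeFn (l := l) hφ hc] with x hx
  rw [hx, RCLike.inner_apply, Complex.conj_ofReal, Complex.real_smul, mul_comm]

theorem primitiveFun_testFunL_deriv {φ : ℝ → ℝ} (hφ : ContDiff ℝ ∞ φ)
    (hc : HasCompactSupport φ) (h0 : φ 0 = 0) {x : ℝ} (hx : x ∈ Icc 0 l) :
    primitiveFun 0 (testFunL l (hφ.continuous_deriv (by simp)) hc.deriv) x = φ x := by
  have hl : 0 ≤ l := hx.1.trans hx.2
  have h1 := (isPrimitiveOn_of_contDiff (l := l) hφ).congr_deriv hl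
    (w' := testFunL l (hφ.continuous_deriv (by simp)) hc.deriv) (by
      filter_upwards [testFunL_coeFn (l := l) (hφ.continuous_deriv (by simp)) hc.deriv] with x hx
      exact hx.symm)
  have h2 := h1.2 x hx
  beta_reduce at h2
  rw [h2, h0, primitiveFun, Complex.ofReal_zero]

theorem primitiveL_testFunL_deriv {φ : ℝ → ℝ} (hφ : ContDiff ℝ ∞ φ)
    (hc : HasCompactSupport φ) (h0 : φ 0 = 0) :
    primitiveL l 0 (testFunL l (hφ.continuous_deriv (by simp)) hc.deriv)
      = testFunL l hφ.continuous hc := by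
  apply Lp.ext
  have h2 : ∀ᵐ x ∂volume.restrict (Ioo (0 : ℝ) l), x ∈ Ioo 0 l :=
    ae_restrict_mem measurableSet_Ioo
  filter_upwards [primitiveL_coeFn 0 (testFunL l (hφ.continuous_deriv (by simp)) hc.deriv),
    testFunL_coeFn (l := l) hφ.continuous hc, h2] with x h3 h4 hx
  rw [h3, h4, primitiveFun_testFunL_deriv hφ hc h0 (Ioo_subset_Icc_self hx)]

theorem eq_zero_of_inner_testFunL_eq_zero {u : IntervalL2 l}
    (h : ∀ (φ : ℝ → ℝ) (hφ : ContDiff ℝ ∞ φ) (hc : HasCompactSupport φ), tsupport φ ⊆ Ioo 0 l →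
      ⟪testFunL l hφ.continuous hc, u⟫_ℂ = 0) : u = 0 := by
  have hw : Integrable (fun x => u x) (volume.restrict (Ioo (0 : ℝ) l)) :=
    (Lp.memLp u).integrable (by norm_num)
  have key := isOpen_Ioo.ae_eq_zero_of_integral_contDiff_smul_eq_zero (μ := volume)
    (U := Ioo (0 : ℝ) l) (f := fun x => u x) (IntegrableOn.locallyIntegrableOn hw) (by
      intro g hg hc hs
      have e : ∫ x, g x • u x = ∫ x in Ioo 0 l, g x • u x := by
        symm
        apply setIntegral_eq_integral_of_forall_compl_eq_zero
        intro x hx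
        rw [image_eq_zero_of_notMem_tsupport (fun hx' => hx (hs hx')), zero_smul]
      rw [e, ← inner_testFunL hg.continuous hc]
      exact h g hg hc hs)
  apply Lp.ext
  rw [← ae_restrict_iff' measurableSet_Ioo] at key
  filter_upwards [key, Lp.coeFn_zero ℂ 2 (volume.restrict (Ioo (0 : ℝ) l))] with x h1 h2
  rw [h1, h2, Pi.zero_apply]

theorem primitiveL_zero_zero : primitiveL l 0 0 = 0 := by
  rw [primitiveL, map_zero, map_zero, add_zero]

theorem primitiveFun_zero_zero {x : ℝ} (hx : x ∈ Icc 0 l) :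
    primitiveFun 0 (0 : IntervalL2 l) x = 0 := by
  rw [primitiveFun, ← integralL_apply le_rfl hx.1 hx.2, map_zero, zero_add]

end TestFunctions

namespace MetricGraph

variable {Vtx E : Type*} [Fintype E] {Γ : MetricGraph Vtx E}

open Classical in
theorem inner_toLp_single (e : E) (u : IntervalL2 (Γ.len e)) (f : Γ.L2) :
    ⟪(WithLp.toLp 2 (Pi.single e u) : Γ.L2), f⟫_ℂ = ⟪u, f e⟫_ℂ := by
  rw [PiLp.inner_apply, Finset.sum_eq_single e]
  · simp
  · intro e' _ he'
    simp [Pi.single_eq_of_ne he']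
  · simp

theorem not_finiteDimensional_L2 [Nonempty E] (Γ : MetricGraph Vtx E) :
    ¬ FiniteDimensional ℂ Γ.L2 := by
  classical
  intro hfin
  obtain ⟨e⟩ := ‹Nonempty E›
  -- multiplication by the coordinate has no eigenvector
  let X : Γ.Potential := ⟨fun _ x => x, fun _ => contDiffOn_id, fun e' => ⟨Γ.len e', fun x hx => by
    rw [abs_of_pos hx.1]; exact hx.2.le⟩⟩
  have hsurj : Function.Surjective (PiLp.projₗ 2 (𝕜 := ℂ) (fun e => IntervalL2 (Γ.len e)) e) :=
    fun u => ⟨WithLp.toLp 2 (Pi.single e u), by simp⟩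
  have : FiniteDimensional ℂ (IntervalL2 (Γ.len e)) := Module.Finite.of_surjective _ hsurj
  have hnt : Nontrivial (IntervalL2 (Γ.len e)) := by
    refine ⟨⟨Lp.const 2 (volume.restrict (Ioo (0 : ℝ) (Γ.len e))) (1 : ℂ), 0, ?_⟩⟩
    have hl := Γ.len_pos e
    have h0 := Lp.norm_const' 2 (volume.restrict (Ioo (0 : ℝ) (Γ.len e))) (1 : ℂ) (by norm_num)
      (by norm_num)
    rw [← norm_ne_zero_iff, h0]
    have h1 : 0 < (volume.restrict (Ioo (0 : ℝ) (Γ.len e))).real univ := by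
      simp [Measure.real, ENNReal.toReal_ofReal hl.le, hl]
    have := Real.rpow_pos_of_pos h1 (1 / (2 : ENNReal).toReal)
    simpa using this.ne'
  obtain ⟨z, hz⟩ := Module.End.exists_eigenvalue (X.mul e : Module.End ℂ (IntervalL2 (Γ.len e)))
  obtain ⟨u, hu, hu0⟩ := hz.exists_hasEigenvector
  have hu' : X.mul e u = z • u := Module.End.mem_eigenspace_iff.mp hu
  apply hu0
  apply Lp.ext
  have h1 : ∀ᵐ x ∂volume.restrict (Ioo (0 : ℝ) (Γ.len e)), X.mul e u x = (x : ℂ) * u x :=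
    (X.memLp_mul e u).coeFn_toLp
  have h2 : ∀ᵐ x ∂volume.restrict (Ioo (0 : ℝ) (Γ.len e)), x ≠ z.re := by
    apply ae_restrict_of_ae
    simp [ae_iff, measure_singleton]
  filter_upwards [h1, h2, Lp.coeFn_smul z u, Lp.coeFn_zero ℂ 2
    (volume.restrict (Ioo (0 : ℝ) (Γ.len e)))] with x h3 h4 h5 h6
  rw [hu', h5, Pi.smul_apply, smul_eq_mul] at h3
  have h7 : (z - x) * u x = 0 := by rw [sub_mul, h3, sub_self]
  rw [h6, Pi.zero_apply]
  refine (mul_eq_zero.mp h7).resolve_left fun h8 => h4 ?_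
  rw [sub_eq_zero] at h8
  rw [h8, Complex.ofReal_re]

variable [Fintype Vtx]

/-- A test function on an edge belongs to the form domain. -/
theorem exists_formDomain_test (Γ : MetricGraph Vtx E) (e : E) {φ : ℝ → ℝ} (hφ : ContDiff ℝ ∞ φ)
    (hc : HasCompactSupport φ) (hs : tsupport φ ⊆ Ioo 0 (Γ.len e)) :
    ∃ y : Γ.FormDomain, Γ.vertexValue y = 0 ∧
      (∀ f, ⟪Γ.derivative y, f⟫_ℂ
        = ⟪testFunL _ (hφ.continuous_deriv (by simp)) hc.deriv, f e⟫_ℂ) ∧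
      ∀ f, ⟪Γ.embed y, f⟫_ℂ = ⟪testFunL _ hφ.continuous hc, f e⟫_ℂ := by
  classical
  have h0 : ∀ x, x ∉ Ioo 0 (Γ.len e) → φ x = 0 := fun x hx =>
    image_eq_zero_of_notMem_tsupport fun hx' => hx (hs hx')
  have h00 : φ 0 = 0 := h0 0 (by simp)
  obtain ⟨y, hy1, hy2⟩ := exists_formDomain (Γ := Γ) (a := 0) (g := WithLp.toLp 2
    (Pi.single e (testFunL _ (hφ.continuous_deriv (by simp)) hc.deriv))) (by
      intro e'
      by_cases h : e' = e
      · subst h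
        simp only [PiLp.zero_apply, Pi.single_eq_same]
        rw [primitiveFun_testFunL_deriv hφ hc h00 (right_mem_Icc.mpr (Γ.len_pos _).le),
          h0 _ (by simp), Complex.ofReal_zero]
      · simp only [PiLp.zero_apply, Pi.single_eq_of_ne h]
        rw [primitiveFun_zero_zero (right_mem_Icc.mpr (Γ.len_pos _).le)])
  refine ⟨y, hy1, fun f => by rw [hy2, inner_toLp_single], fun f => ?_⟩
  rw [← inner_toLp_single]
  congr 1
  ext1 e'
  rw [embed_apply, hy1, hy2]
  by_cases h : e' = e
  · subst h
    simp only [PiLp.zero_apply, Pi.single_eq_same]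
    exact primitiveL_testFunL_deriv hφ hc h00
  · simp only [PiLp.zero_apply, Pi.single_eq_of_ne h]
    exact primitiveL_zero_zero

/-- The form domain is dense in `L²(Γ)`. -/
theorem eq_zero_of_inner_embed_eq_zero {f : Γ.L2} (h : ∀ y, ⟪Γ.embed y, f⟫_ℂ = 0) : f = 0 := by
  ext1 e
  refine eq_zero_of_inner_testFunL_eq_zero fun φ hφ hc hs => ?_
  obtain ⟨y, -, -, hy⟩ := Γ.exists_formDomain_test e hφ hc hs
  rw [← hy, h]

end MetricGraph

/-! ### Eigenfunctions of the form and of the Schrödinger operator -/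

namespace MetricGraph

variable {Vtx E : Type*} [Fintype E] [Fintype Vtx] {Γ : MetricGraph Vtx E}

/-- An eigenfunction of the form satisfies the eigenvalue equation on every edge. -/
theorem exists_derivative_eq_primitiveL {V : Γ.Potential} {σ : Vtx → ℝ} {ζ : ℂ}
    {y : Γ.FormDomain}
    (h : ∀ z, ⟪formOp V σ y, z⟫_ℂ = conj ζ * ⟪Γ.embed y, Γ.embed z⟫_ℂ) :
    ∃ d : E → ℂ, ∀ e, Γ.derivative y e
      = primitiveL (Γ.len e) (d e) ((V.op (Γ.embed y) - ζ • Γ.embed y) e) := by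
  have key : ∀ e, IsWeakDeriv (Γ.derivative y e) ((V.op (Γ.embed y) - ζ • Γ.embed y) e) := by
    intro e φ hφ hc hs
    obtain ⟨z, hz0, hz1, hz2⟩ := Γ.exists_formDomain_test e hφ hc hs
    have h1 := congrArg (starRingEnd ℂ) (h z)
    rw [inner_formOp, hz0, inner_zero_right, add_zero, map_add, map_mul, Complex.conj_conj,
      inner_conj_symm, inner_conj_symm, inner_conj_symm, hz1, hz2, hz2] at h1
    rw [← inner_testFunL (hφ.continuous_deriv (by simp)) hc.deriv,
      ← inner_testFunL hφ.continuous hc, PiLp.sub_apply, PiLp.smul_apply, inner_sub_right,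
      inner_smul_right]
    linear_combination h1
  choose d hd using fun e => (key e).exists_eq_primitiveL (Γ.len_pos e)
  exact ⟨d, hd⟩

/-- Arbitrary vertex values are attained, by functions that are affine on every edge. -/
theorem exists_formDomain_vertexValue (Γ : MetricGraph Vtx E) (b : EuclideanSpace ℂ Vtx) :
    ∃ z : Γ.FormDomain, Γ.vertexValue z = b := by
  have hc : ∀ (e : E) (c : ℂ), integralL (Γ.len e) 0 (Γ.len e)
      (Lp.constL 2 (volume.restrict (Ioo (0 : ℝ) (Γ.len e))) ℂ c) = Γ.len e * c := by
    intro e c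
    have h : ∫ t in Ioo 0 (Γ.len e),
        Lp.constL 2 (volume.restrict (Ioo (0 : ℝ) (Γ.len e))) ℂ c t
          = ∫ t in Ioo 0 (Γ.len e), c := integral_congr_ae (Lp.coeFn_const 2 _ c)
    rw [integralL_apply le_rfl (Γ.len_pos e).le le_rfl,
      intervalIntegral.integral_of_le (Γ.len_pos e).le, integral_Ioc_eq_integral_Ioo, h]
    simp [(Γ.len_pos e).le]
  obtain ⟨z, hz, -⟩ := exists_formDomain (Γ := Γ) (a := b) (g := WithLp.toLp 2 fun e =>
    Lp.constL 2 (volume.restrict (Ioo (0 : ℝ) (Γ.len e))) ℂ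
      ((b (Γ.tgt e) - b (Γ.src e)) / Γ.len e)) (by
    intro e
    rw [primitiveFun, ← integralL_apply le_rfl (Γ.len_pos e).le le_rfl]
    have hl : (Γ.len e : ℂ) ≠ 0 := by exact_mod_cast (Γ.len_pos e).ne'
    have h1 := hc e ((b (Γ.tgt e) - b (Γ.src e)) / Γ.len e)
    rw [mul_div_cancel₀ _ hl] at h1
    change _ = _ + integralL (Γ.len e) 0 (Γ.len e)
      (Lp.constL 2 (volume.restrict (Ioo (0 : ℝ) (Γ.len e))) ℂ _)
    rw [h1]
    ring)
  exact ⟨z, hz⟩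

variable [DecidableEq Vtx]

/-- The sum of the inward derivatives over all edge ends at `v`, for given derivatives `p e` and
`q e` at the two ends of each edge. -/
def flux (Γ : MetricGraph Vtx E) (p q : E → ℂ) (v : Vtx) : ℂ :=
  ∑ e, ((if Γ.src e = v then p e else 0) + (if Γ.tgt e = v then -q e else 0))

theorem sum_conj_flux_mul (p q : E → ℂ) (b : Vtx → ℂ) :
    ∑ v, conj (Γ.flux p q v) * b v
      = ∑ e, (conj (p e) * b (Γ.src e) - conj (q e) * b (Γ.tgt e)) := by
  simp only [flux, map_sum, map_add, Finset.sum_mul]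
  rw [Finset.sum_comm]
  refine Finset.sum_congr rfl fun e _ => ?_
  have h1 : ∀ v, (conj (if Γ.src e = v then p e else 0) + conj (if Γ.tgt e = v then -q e else 0))
      * b v = (if Γ.src e = v then conj (p e) * b v else 0)
        + (if Γ.tgt e = v then -(conj (q e) * b v) else 0) := by
    intro v
    split_ifs <;> simp [add_mul]
  simp only [h1, Finset.sum_add_distrib, Finset.sum_ite_eq, Finset.mem_univ, if_true]
  ring

/-- Integration by parts on the graph. -/
theorem inner_derivative_eq {y : Γ.FormDomain} {d : E → ℂ} {r : Γ.L2}
    (h : ∀ e, Γ.derivative y e = primitiveL (Γ.len e) (d e) (r e)) (z : Γ.FormDomain) :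
    ⟪Γ.derivative y, Γ.derivative z⟫_ℂ = -⟪r, Γ.embed z⟫_ℂ
      - ∑ v, conj (Γ.flux d (fun e => primitiveFun (d e) (r e) (Γ.len e)) v)
        * Γ.vertexValue z v := by
  rw [sum_conj_flux_mul, PiLp.inner_apply, PiLp.inner_apply, ← Finset.sum_neg_distrib,
    ← Finset.sum_sub_distrib]
  refine Finset.sum_congr rfl fun e _ => ?_
  have h1 := inner_add_inner_primitiveL (Γ.len_pos e).le (d e) (Γ.vertexValue z (Γ.src e)) (r e)
    (Γ.derivative z e)
  rw [← vertexValue_tgt, ← h, ← embed_apply] at h1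
  linear_combination h1

/-- The defect in the weak eigenvalue equation splits into the defect of the differential equation
on the edges and the defect of the coupling conditions at the vertices. -/
theorem inner_formOp_sub_eq {y : Γ.FormDomain} {d : E → ℂ} {r : Γ.L2}
    (h : ∀ e, Γ.derivative y e = primitiveL (Γ.len e) (d e) (r e)) (V : Γ.Potential)
    (σ : Vtx → ℝ) (ζ : ℂ) (z : Γ.FormDomain) :
    ⟪formOp V σ y, z⟫_ℂ - conj ζ * ⟪Γ.embed y, Γ.embed z⟫_ℂ
      = ⟪-r + V.op (Γ.embed y) - ζ • Γ.embed y, Γ.embed z⟫_ℂ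
      + ∑ v, conj (σ v * Γ.vertexValue y v
        - Γ.flux d (fun e => primitiveFun (d e) (r e) (Γ.len e)) v) * Γ.vertexValue z v := by
  rw [inner_formOp, inner_derivative_eq h, inner_vertexOp, inner_sub_left, inner_add_left,
    inner_neg_left, inner_smul_left]
  simp only [map_sub, map_mul, Complex.conj_ofReal, sub_mul, Finset.sum_sub_distrib]
  ring

/-- The eigenfunctions of the Schrödinger operator are those of its quadratic form. -/
theorem mem_eigenspace_schrodinger_iff (V : Γ.Potential) (σ : Vtx → ℝ) (ζ : ℂ) (f : Γ.L2) :
    f ∈ eigenspace (Γ.schrodinger V σ) ζ ↔ ∃ y, Γ.embed y = f ∧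
      ∀ z, ⟪formOp V σ y, z⟫_ℂ = conj ζ * ⟪Γ.embed y, Γ.embed z⟫_ℂ := by
  constructor
  · rintro ⟨⟨hf2, a, p, q, h1, h2, h3⟩, heq⟩
    choose c hc using fun e => (isWeakDeriv_weakDeriv (hf2 e).1).exists_eq_primitiveL (Γ.len_pos e)
    choose d hd using fun e => (isWeakDeriv_weakDeriv (hf2 e).2).exists_eq_primitiveL (Γ.len_pos e)
    have hbv : ∀ e, c e = a (Γ.src e) ∧
        primitiveFun (c e) (weakDeriv (f e)) (Γ.len e) = a (Γ.tgt e) := fun e => by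
      have h := hasBoundaryValues_primitiveL (Γ.len_pos e).le (c e) (weakDeriv (f e))
      rw [← hc] at h
      exact h.unique (Γ.len_pos e) (h1 e)
    have hbd : ∀ e, d e = p e ∧
        primitiveFun (d e) (weakDeriv (weakDeriv (f e))) (Γ.len e) = q e := fun e => by
      have h := hasBoundaryValues_primitiveL (Γ.len_pos e).le (d e) (weakDeriv (weakDeriv (f e)))
      rw [← hd] at h
      exact h.unique (Γ.len_pos e) (h2 e)
    obtain ⟨y, hy1, hy2⟩ := exists_formDomain (Γ := Γ) (a := WithLp.toLp 2 a)
      (g := WithLp.toLp 2 fun e => weakDeriv (f e)) (fun e => by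
        change a (Γ.tgt e) = primitiveFun (a (Γ.src e)) (weakDeriv (f e)) (Γ.len e)
        rw [← (hbv e).2, (hbv e).1])
    have hyf : Γ.embed y = f := by
      ext1 e
      rw [embed_apply, hy1, hy2]
      change primitiveL _ (a (Γ.src e)) (weakDeriv (f e)) = f e
      rw [← (hbv e).1, ← hc]
    refine ⟨y, hyf, fun z => ?_⟩
    have hdy : ∀ e, Γ.derivative y e = primitiveL (Γ.len e) (d e)
        ((WithLp.toLp 2 fun e => weakDeriv (weakDeriv (f e)) : Γ.L2) e) := fun e => by
      rw [hy2]
      exact hd e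
    have h4 := inner_formOp_sub_eq hdy V σ ζ z
    have h5 : -(WithLp.toLp 2 fun e => weakDeriv (weakDeriv (f e)) : Γ.L2) + V.op (Γ.embed y)
        - ζ • Γ.embed y = 0 := by
      rw [hyf, sub_eq_zero, ← heq]
      rfl
    have h6 : ∀ v, σ v * Γ.vertexValue y v - Γ.flux d (fun e => primitiveFun (d e)
        ((WithLp.toLp 2 fun e => weakDeriv (weakDeriv (f e)) : Γ.L2) e) (Γ.len e)) v = 0 := by
      intro v
      rw [hy1, sub_eq_zero]
      refine (h3 v).symm.trans (Finset.sum_congr rfl fun e _ => ?_)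
      rw [← (hbd e).1, ← (hbd e).2]
    rw [h5, inner_zero_left, zero_add, Finset.sum_eq_zero, sub_eq_zero] at h4
    · exact h4
    · intro v _
      rw [h6, map_zero, zero_mul]
  · rintro ⟨y, rfl, h⟩
    obtain ⟨d, hd⟩ := exists_derivative_eq_primitiveL h
    set r := V.op (Γ.embed y) - ζ • Γ.embed y with hr
    have hw1 : ∀ e, IsWeakDeriv (Γ.embed y e) (Γ.derivative y e) := fun e =>
      isWeakDeriv_primitiveL (Γ.len_pos e).le _ _
    have hw2 : ∀ e, IsWeakDeriv (Γ.derivative y e) (r e) := fun e => by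
      rw [hd]
      exact isWeakDeriv_primitiveL (Γ.len_pos e).le _ _
    have hflux : ∀ v, Γ.flux d (fun e => primitiveFun (d e) (r e) (Γ.len e)) v
        = σ v * Γ.vertexValue y v := by
      intro v
      obtain ⟨z, hz⟩ := Γ.exists_formDomain_vertexValue (EuclideanSpace.single v 1)
      have h4 := inner_formOp_sub_eq hd V σ ζ z
      have h5 : -r + V.op (Γ.embed y) - ζ • Γ.embed y = 0 := by rw [hr]; abel
      rw [h, sub_self, h5, inner_zero_left, zero_add, hz, Finset.sum_eq_single v] at h4
      · rw [PiLp.single_apply, if_pos rfl, mul_one] at h4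
        have h6 := congrArg (starRingEnd ℂ) h4
        rw [map_zero, Complex.conj_conj] at h6
        exact (sub_eq_zero.mp h6.symm).symm
      · intro v' _ hv'
        rw [PiLp.single_apply, if_neg hv', mul_zero]
      · simp
    have hdom : Γ.embed y ∈ (Γ.schrodinger V σ).domain := by
      refine ⟨fun e => ⟨⟨_, hw1 e⟩, ⟨r e, ?_⟩⟩, fun v => Γ.vertexValue y v, d,
        fun e => primitiveFun (d e) (r e) (Γ.len e), fun e => ?_, fun e => ?_, hflux⟩
      · rw [(hw1 e).weakDeriv_eq]
        exact hw2 e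
      · dsimp only
        rw [vertexValue_tgt]
        exact hasBoundaryValues_primitiveL (Γ.len_pos e).le _ _
      · rw [(hw1 e).weakDeriv_eq, hd]
        exact hasBoundaryValues_primitiveL (Γ.len_pos e).le _ _
    refine ⟨hdom, ?_⟩
    ext1 e
    change -weakDeriv (weakDeriv (Γ.embed y e)) + V.mul e (Γ.embed y e) = ζ • Γ.embed y e
    have hre : r e = V.mul e (Γ.embed y e) - ζ • Γ.embed y e := rfl
    rw [(hw1 e).weakDeriv_eq, (hw2 e).weakDeriv_eq, hre]
    abel

end MetricGraph

/-! ### Eigenvalue asymptotics -/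

theorem sum_smul_primitiveL {ι : Type*} (s : Finset ι) (l : ℝ) (c d : ι → ℂ)
    (w : ι → IntervalL2 l) : ∑ i ∈ s, c i • primitiveL l (d i) (w i)
      = primitiveL l (∑ i ∈ s, c i • d i) (∑ i ∈ s, c i • w i) := by
  simp only [primitiveL, smul_add, Finset.sum_add_distrib, map_sum, map_smul]

theorem norm_sum_smul_sq {ι H : Type*} [NormedAddCommGroup H] [InnerProductSpace ℂ H] {v : ι → H}
    (hv : Orthonormal ℂ v) (s : Finset ι) (c : ι → ℂ) :
    ‖∑ i ∈ s, c i • v i‖ ^ 2 = ∑ i ∈ s, ‖c i‖ ^ 2 := by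
  have h := hv.inner_sum c c s
  rw [inner_self_eq_norm_sq_to_K] at h
  simp only [Complex.conj_mul'] at h
  have h1 : ((‖∑ i ∈ s, c i • v i‖ ^ 2 : ℝ) : ℂ) = ((∑ i ∈ s, ‖c i‖ ^ 2 : ℝ) : ℂ) := by
    push_cast
    exact h
  exact Complex.ofReal_injective h1

namespace MetricGraph

variable {Vtx E : Type*} [Fintype E] [Fintype Vtx] {Γ : MetricGraph Vtx E}
  {V : Γ.Potential} {σ : Vtx → ℝ} {lam : ℕ → ℝ} {w : ℕ → Γ.FormDomain}

theorem exists_derivative_eq_of_isFormSpectrum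
    (h : IsFormSpectrum Γ.embed (formOp V σ) lam w) (n : ℕ) :
    ∃ d : E → ℂ, ∀ e, Γ.derivative (w n) e = primitiveL (Γ.len e) (d e)
      ((V.op (Γ.embed (w n)) - (lam n : ℂ) • Γ.embed (w n)) e) :=
  exists_derivative_eq_primitiveL fun z => by rw [h.eigen, Complex.conj_ofReal]

/-- The normalised eigenfunctions are uniformly bounded at the vertices. For large eigenvalues this
is the near-conservation of the energy `|f'|² + λ |f|²` along each edge. -/
theorem Connected.exists_norm_vertexValue_eigenvector_sq_le [Nonempty E] (hΓ : Γ.Connected)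
    (h : IsFormSpectrum Γ.embed (formOp V σ) lam w) :
    ∃ K, ∀ k, ‖Γ.vertexValue (w k)‖ ^ 2 ≤ K := by
  obtain ⟨c, hc0, hc⟩ := hΓ.exists_le_re_inner_formOp V σ
  choose e x hx hv using hΓ.exists_vertexValue_eq
  set B : Vtx → ℝ := fun v =>
    ((1 + Γ.len (e v)) * (2 * (1 + c)) + 1 + Γ.len (e v) * ‖V.op‖ ^ 2) / Γ.len (e v) with hB
  have hB0 : ∀ v, 0 ≤ B v := fun v => by
    have := Γ.len_pos (e v)
    positivity
  refine ⟨2 * (1 + c) + ∑ v, B v, fun k => ?_⟩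
  have hJ : ‖Γ.embed (w k)‖ = 1 := h.orthonormal.1 k
  have hn : ‖w k‖ ^ 2 ≤ 2 * (lam k + c) := by
    have h1 := hc (w k)
    rw [h.eigen, inner_self_eq_norm_sq_to_K, hJ] at h1
    norm_num at h1
    linarith
  rw [norm_sq_formDomain] at hn
  rcases lt_or_ge (lam k) 1 with hlam | hlam
  · have h2 : 0 ≤ ∑ v, B v := Finset.sum_nonneg fun v _ => hB0 v
    nlinarith [sq_nonneg ‖Γ.derivative (w k)‖]
  · obtain ⟨d, hd⟩ := exists_derivative_eq_of_isFormSpectrum h k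
    suffices h3 : ∀ v, ‖Γ.vertexValue (w k) v‖ ^ 2 ≤ B v by
      rw [PiLp.norm_sq_eq_of_L2]
      refine (Finset.sum_le_sum fun v _ => h3 v).trans ?_
      linarith
    intro v
    have hl := Γ.len_pos (e v)
    have h1 := (abs_le.mp (abs_energy_sub_le (lam := lam k) (g := V.op (Γ.embed (w k)) (e v))
      (Γ.embed_apply (w k) (e v)) (hd (e v)) (by
        rw [PiLp.sub_apply, PiLp.smul_apply]
        abel) (hx v) one_pos)).1
    rw [← hv] at h1
    have h4 := norm_apply_sq_le (Γ.derivative (w k)) (e v)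
    have h5 := norm_apply_sq_le (Γ.embed (w k)) (e v)
    have h6 := norm_apply_sq_le (V.op (Γ.embed (w k))) (e v)
    have h7 : ‖V.op (Γ.embed (w k))‖ ^ 2 ≤ ‖V.op‖ ^ 2 := by
      have := V.op.le_opNorm (Γ.embed (w k))
      rw [hJ, mul_one] at this
      gcongr
    rw [hJ, one_pow] at h5
    have h8 : ‖Γ.derivative (w k) (e v)‖ ^ 2 ≤ 2 * (1 + c) * lam k := by
      nlinarith [sq_nonneg ‖Γ.vertexValue (w k)‖]
    rw [hB, le_div_iff₀ hl]
    refine le_of_mul_le_mul_left ?_ (zero_lt_one.trans_le hlam)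
    have h9 : (1 + Γ.len (e v)) * ‖Γ.derivative (w k) (e v)‖ ^ 2
        ≤ (1 + Γ.len (e v)) * (2 * (1 + c) * lam k) := by gcongr
    have h10 : Γ.len (e v) * ‖V.op (Γ.embed (w k)) (e v)‖ ^ 2
        ≤ lam k * (Γ.len (e v) * ‖V.op‖ ^ 2) := by
      have h11 : Γ.len (e v) * ‖V.op (Γ.embed (w k)) (e v)‖ ^ 2 ≤ Γ.len (e v) * ‖V.op‖ ^ 2 :=
        mul_le_mul_of_nonneg_left (h6.trans h7) hl.le
      exact h11.trans (le_mul_of_one_le_left (by positivity) hlam)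
    have h12 : lam k * ‖Γ.embed (w k) (e v)‖ ^ 2 ≤ lam k :=
      mul_le_of_le_one_right (zero_le_one.trans hlam) h5
    have h13 : 0 ≤ Γ.len (e v) * ‖primitiveFun (d (e v))
        ((V.op (Γ.embed (w k)) - (lam k : ℂ) • Γ.embed (w k)) (e v)) (x v)‖ ^ 2 := by positivity
    rw [div_one, one_mul] at h1
    linarith

/-- More than `2 |E|` eigenvalues cannot crowd together: otherwise some combination of the
eigenfunctions has zero initial data on every edge and almost satisfies a single eigenvalue
equation, so that it is too small to carry its own norm. -/
theorem le_mul_of_eigenvalues_mem_Icc (h : IsFormSpectrum Γ.embed (formOp V σ) lam w)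
    {L a δ : ℝ} (hL0 : 0 ≤ L) (hL : ∀ e, Γ.len e ≤ L) (hδ : 0 ≤ δ) {k : ℕ}
    (hk : ∀ i ≤ 2 * Fintype.card E, lam (k + i) ∈ Icc (a ^ 2) (a ^ 2 + δ)) :
    a ≤ L * (‖V.op‖ + δ) := by
  choose d hd using exists_derivative_eq_of_isFormSpectrum h
  set N := 2 * Fintype.card E with hN
  -- the initial data of the eigenfunctions on all edges lie in a space of dimension `2 |E|`
  have hdep : ¬ LinearIndependent ℂ (fun i : Fin (N + 1) =>
      ((d (k + i), fun e => Γ.vertexValue (w (k + i)) (Γ.src e)) : (E → ℂ) × (E → ℂ))) := by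
    intro hli
    have h1 := hli.fintype_card_le_finrank
    rw [Fintype.card_fin, Module.finrank_prod, Module.finrank_fintype_fun_eq_card] at h1
    omega
  obtain ⟨c, hc, i₀, hi₀⟩ := Fintype.not_linearIndependent_iff.mp hdep
  have hc1 : ∀ e, ∑ i, c i • d (k + i) e = 0 := fun e => by
    have := congrFun (congrArg Prod.fst hc) e
    simpa [Prod.fst_sum, Finset.sum_apply] using this
  have hc2 : ∀ e, ∑ i, c i • Γ.vertexValue (w (k + i)) (Γ.src e) = 0 := fun e => by
    have := congrFun (congrArg Prod.snd hc) e
    simpa [Prod.snd_sum, Finset.sum_apply] using this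
  have hon : Orthonormal ℂ (fun i : Fin (N + 1) => Γ.embed (w (k + i))) :=
    h.orthonormal.comp (fun i : Fin (N + 1) => k + (i : ℕ)) fun i j hij =>
      Fin.ext (Nat.add_left_cancel hij)
  -- `f` is the combination with zero initial data, `p` its derivative, and `f'' = -a² f + V f + q`
  set f : Γ.L2 := ∑ i, c i • Γ.embed (w (k + i)) with hf
  set p : Γ.L2 := ∑ i, c i • Γ.derivative (w (k + i)) with hp
  set q : Γ.L2 := ∑ i, (c i * ((a ^ 2 - lam (k + i) : ℝ) : ℂ)) • Γ.embed (w (k + i)) with hq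
  have hfe : ∀ e, f e = primitiveL (Γ.len e) 0 (p e) := fun e => by
    rw [hf, hp, WithLp.ofLp_sum, WithLp.ofLp_sum, Finset.sum_apply, Finset.sum_apply, ← hc2 e]
    exact sum_smul_primitiveL _ _ _ _ _
  have hpe : ∀ e, p e = primitiveL (Γ.len e) 0
      ((-((a ^ 2 : ℝ) : ℂ) • f + (V.op f + q)) e) := fun e => by
    have h1 : -((a ^ 2 : ℝ) : ℂ) • f + (V.op f + q) = ∑ i, c i •
        (V.op (Γ.embed (w (k + i))) - (lam (k + i) : ℂ) • Γ.embed (w (k + i))) := by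
      rw [hf, hq, map_sum, Finset.smul_sum, ← Finset.sum_add_distrib, ← Finset.sum_add_distrib]
      refine Finset.sum_congr rfl fun i _ => ?_
      rw [map_smul, Complex.ofReal_sub]
      module
    rw [h1, hp, WithLp.ofLp_sum, WithLp.ofLp_sum, Finset.sum_apply, Finset.sum_apply, ← hc1 e]
    refine Eq.trans ?_ (sum_smul_primitiveL _ _ _ _ _)
    exact Finset.sum_congr rfl fun i _ => congrArg (c i • ·) (hd _ e)
  have hqf : ‖q‖ ≤ δ * ‖f‖ := by
    refine (le_abs_self _).trans (abs_le_of_sq_le_sq ?_ (by positivity))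
    rw [mul_pow, hf, hq, norm_sum_smul_sq hon, norm_sum_smul_sq hon, Finset.mul_sum]
    refine Finset.sum_le_sum fun i _ => ?_
    have h1 := hk i (by omega)
    rw [norm_mul, mul_pow, mul_comm, Complex.norm_real, Real.norm_eq_abs, sq_abs]
    refine mul_le_mul_of_nonneg_right ?_ (sq_nonneg _)
    nlinarith [h1.1, h1.2]
  have hf0 : 0 < ‖f‖ := by
    refine norm_pos_iff.mpr fun h0 => hi₀ ?_
    have h1 := norm_sum_smul_sq hon Finset.univ c
    rw [← hf, h0, norm_zero, zero_pow two_ne_zero, eq_comm,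
      Finset.sum_eq_zero_iff_of_nonneg fun _ _ => sq_nonneg _] at h1
    simpa using h1 i₀ (Finset.mem_univ _)
  clear_value f p q
  have hsq : a ^ 2 * ‖f‖ ^ 2 ≤ L ^ 2 * ‖V.op f + q‖ ^ 2 := by
    rw [PiLp.norm_sq_eq_of_L2, PiLp.norm_sq_eq_of_L2, Finset.mul_sum, Finset.mul_sum]
    refine Finset.sum_le_sum fun e _ => ?_
    have hl := Γ.len_pos e
    have h1 := (abs_le.mp (abs_energy_sub_le (lam := a ^ 2) (g := (V.op f + q) e) (hfe e) (hpe e)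
      (by rw [PiLp.add_apply, PiLp.smul_apply, neg_smul])
      (left_mem_Icc.mpr hl.le) hl)).2
    rw [primitiveFun_zero, primitiveFun_zero] at h1
    have h2 : Γ.len e * (Γ.len e * ‖(V.op f + q) e‖ ^ 2 + ‖p e‖ ^ 2 / Γ.len e)
        = Γ.len e ^ 2 * ‖(V.op f + q) e‖ ^ 2 + ‖p e‖ ^ 2 := by
      field_simp
    have h3 : Γ.len e ^ 2 * ‖(V.op f + q) e‖ ^ 2 ≤ L ^ 2 * ‖(V.op f + q) e‖ ^ 2 := by
      have := hL e
      gcongr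
    rw [h2, norm_zero] at h1
    linarith
  have h2 : ‖V.op f + q‖ ≤ (‖V.op‖ + δ) * ‖f‖ := by
    rw [add_mul]
    exact (norm_add_le _ _).trans (add_le_add (V.op.le_opNorm f) hqf)
  have h3 : (a * ‖f‖) ^ 2 ≤ (L * ((‖V.op‖ + δ) * ‖f‖)) ^ 2 := by
    rw [mul_pow, mul_pow L]
    exact hsq.trans (by gcongr)
  have h4 := (le_abs_self _).trans (abs_le_of_sq_le_sq h3 (by positivity))
  rw [← mul_assoc] at h4
  exact le_of_mul_le_mul_right h4 hf0

/-- The square roots of the large eigenvalues have a gap in any `2 |E|` steps, so that the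
eigenvalues grow quadratically along arithmetic progressions. -/
theorem exists_mul_sq_le_eigenvalue_sub [Nonempty E]
    (h : IsFormSpectrum Γ.embed (formOp V σ) lam w) :
    ∃ ε, 0 < ε ∧ ∃ k₀, ∀ k, k₀ ≤ k → ∀ j : ℕ,
      ε * (j : ℝ) ^ 2 ≤ lam (k + j * (2 * Fintype.card E)) - lam k := by
  set L := ∑ e, Γ.len e with hLdef
  have hL : ∀ e, Γ.len e ≤ L := fun e =>
    Finset.single_le_sum (f := Γ.len) (fun e _ => (Γ.len_pos e).le) (Finset.mem_univ e)
  have hL0 : 0 < L := (Γ.len_pos (Classical.arbitrary E)).trans_le (hL _)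
  set N := 2 * Fintype.card E with hN
  set η := 1 / (4 * L) with hη
  have hη0 : 0 < η := by positivity
  -- beyond `a₀`, a window of width `η` for the square roots is too narrow for `N + 1` eigenvalues
  set a₀ := 2 * L * (‖V.op‖ + η ^ 2) + 1 with ha₀
  have ha₀0 : 0 < a₀ := by positivity
  obtain ⟨k₀, hk₀⟩ := (h.tendsto.eventually_ge_atTop (a₀ ^ 2)).exists_forall_of_atTop
  have hstep : ∀ k, k₀ ≤ k → √(lam k) + η ≤ √(lam (k + N)) := by
    intro k hk
    by_contra! hlt
    have ha : a₀ ≤ √(lam k) := Real.le_sqrt_of_sq_le (hk₀ k hk)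
    have hlk : √(lam k) ^ 2 = lam k := Real.sq_sqrt ((sq_nonneg _).trans (hk₀ k hk))
    have h1 := le_mul_of_eigenvalues_mem_Icc h (a := √(lam k)) (δ := η * (2 * √(lam k) + η)) hL0.le
      hL (by positivity) (k := k) (fun i hi => by
        rw [hlk]
        refine ⟨h.monotone (Nat.le_add_right _ _), (h.monotone (Nat.add_le_add_left hi k)).trans ?_⟩
        have h2 := (Real.sqrt_lt' (by positivity)).mp hlt
        rw [← hN]
        nlinarith)
    have h3 : L * η = 1 / 4 := by
      rw [hη]
      field_simp
    have h4 : L * (‖V.op‖ + η * (2 * √(lam k) + η))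
        = L * (‖V.op‖ + η ^ 2) + √(lam k) / 2 := by linear_combination (2 * √(lam k)) * h3
    rw [h4] at h1
    linarith
  have hiter : ∀ k, k₀ ≤ k → ∀ j : ℕ, √(lam k) + j * η ≤ √(lam (k + j * N)) := by
    intro k hk j
    induction j with
    | zero => simp
    | succ j ih =>
      have h1 := hstep (k + j * N) (hk.trans (Nat.le_add_right _ _))
      rw [show k + (j + 1) * N = k + j * N + N by ring]
      push_cast
      linarith
  refine ⟨η ^ 2, by positivity, k₀, fun k hk j => ?_⟩
  have h1 := hiter k hk j
  have h2 : 0 ≤ lam k := (sq_nonneg _).trans (hk₀ k hk)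
  have h3 : 0 ≤ lam (k + j * N) := h2.trans (h.monotone (Nat.le_add_right _ _))
  have h4 : (√(lam k) + j * η) ^ 2 ≤ lam (k + j * N) :=
    (Real.le_sqrt (by positivity) h3).mp h1
  have h5 := Real.sq_sqrt h2
  have h6 : 0 ≤ √(lam k) * (j * η) := by positivity
  nlinarith

theorem Connected.exists_eigenvalue_le_add [Nonempty E] (hΓ : Γ.Connected) {V' : Γ.Potential}
    {σ' : Vtx → ℝ} {lam' : ℕ → ℝ} {w' : ℕ → Γ.FormDomain}
    (h : IsFormSpectrum Γ.embed (formOp V σ) lam w)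
    (h' : IsFormSpectrum Γ.embed (formOp V' σ') lam' w') :
    ∃ C, ∀ n, lam' n ≤ lam n + C := by
  obtain ⟨K, hK⟩ := hΓ.exists_norm_vertexValue_eigenvector_sq_le h
  obtain ⟨ε, hε, k₀, hsp⟩ := exists_mul_sq_le_eigenvalue_sub h
  refine h.exists_le_add h' (P := Γ.vertexValue) (M := ‖V.op‖ + ‖V'.op‖)
    (s := ‖vertexOp σ‖ + ‖vertexOp σ'‖) (by positivity) (fun y => ?_) hK
    (N := 2 * Fintype.card E) (by have := Fintype.card_pos (α := E); omega) hε hsp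
  have h1 := (abs_le.mp (abs_re_inner_formOp_sub_le V σ y)).1
  have h2 := (abs_le.mp (abs_re_inner_formOp_sub_le V' σ' y)).2
  linarith

theorem Connected.exists_isFormSpectrum_formOp [Nonempty E] (hΓ : Γ.Connected)
    (V : Γ.Potential) (σ : Vtx → ℝ) :
    ∃ lam w, IsFormSpectrum Γ.embed (formOp V σ) lam w := by
  obtain ⟨c, -, hc⟩ := hΓ.exists_le_re_inner_formOp V σ
  exact exists_isFormSpectrum Γ.isCompactOperator_embed
    (fun _ => eq_zero_of_inner_embed_eq_zero)
    Γ.not_finiteDimensional_L2 (isSymmetric_formOp V σ) one_half_pos hc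

theorem Connected.exists_abs_eigenvalue_sub_le [Nonempty E] (hΓ : Γ.Connected) {V' : Γ.Potential}
    {σ' : Vtx → ℝ} {lam' : ℕ → ℝ} {w' : ℕ → Γ.FormDomain}
    (h : IsFormSpectrum Γ.embed (formOp V σ) lam w)
    (h' : IsFormSpectrum Γ.embed (formOp V' σ') lam' w') :
    ∃ C, ∀ n, |lam n - lam' n| ≤ C := by
  obtain ⟨C₁, hC₁⟩ := hΓ.exists_eigenvalue_le_add h h'
  obtain ⟨C₂, hC₂⟩ := hΓ.exists_eigenvalue_le_add h' h
  refine ⟨max C₁ C₂, fun n => abs_le.mpr ⟨?_, ?_⟩⟩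
  · linarith [hC₁ n, le_max_left C₁ C₂]
  · linarith [hC₂ n, le_max_right C₁ C₂]

end MetricGraph

end QuantumGraph

end

theorem mainTheorem3 {Vtx E : Type*} [Fintype Vtx] [DecidableEq Vtx] [Fintype E] [Nonempty E]
    (Γ : QuantumGraph.MetricGraph Vtx E) (hΓ : Γ.Connected) (V : Γ.Potential) (σ : Vtx → ℝ) :
    ∃ lamVσ lamV0 lam00 : ℕ → ℝ,
      QuantumGraph.IsEigenvalueEnumeration (Γ.schrodinger V σ) lamVσ ∧
      QuantumGraph.IsEigenvalueEnumeration (Γ.schrodinger V 0) lamV0 ∧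
      QuantumGraph.IsEigenvalueEnumeration (Γ.schrodinger 0 0) lam00 ∧
      ∃ C : ℝ, 0 < C ∧ ∀ n : ℕ, |lamVσ n - lamV0 n| ≤ C ∧ |lamVσ n - lam00 n| ≤ C := by
  obtain ⟨lam, w, h⟩ := hΓ.exists_isFormSpectrum_formOp V σ
  obtain ⟨lam', w', h'⟩ := hΓ.exists_isFormSpectrum_formOp V 0
  obtain ⟨lam'', w'', h''⟩ := hΓ.exists_isFormSpectrum_formOp 0 0
  obtain ⟨C, hC⟩ := hΓ.exists_abs_eigenvalue_sub_le h h'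
  obtain ⟨C', hC'⟩ := hΓ.exists_abs_eigenvalue_sub_le h h''
  refine ⟨lam, lam', lam'',
    h.isEigenvalueEnumeration (QuantumGraph.MetricGraph.isSymmetric_formOp V σ)
      (QuantumGraph.MetricGraph.mem_eigenspace_schrodinger_iff V σ),
    h'.isEigenvalueEnumeration (QuantumGraph.MetricGraph.isSymmetric_formOp V 0)
      (QuantumGraph.MetricGraph.mem_eigenspace_schrodinger_iff V 0),
    h''.isEigenvalueEnumeration (QuantumGraph.MetricGraph.isSymmetric_formOp 0 0)
      (QuantumGraph.MetricGraph.mem_eigenspace_schrodinger_iff 0 0),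
    max 1 (max C C'), by positivity, fun n => ⟨?_, ?_⟩⟩
  · exact (hC n).trans ((le_max_left _ _).trans (le_max_right _ _))
  · exact (hC' n).trans ((le_max_right _ _).trans (le_max_right _ _))
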